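/- Theorem. Let $T>0$, $1<p<\infty$, let $\Theta\subset\mathbb{R}^l$ be compact and let $\mathcal{U}:=L^p([0,T],\mathbb{R}^k)$. Let $F_0:\mathbb{R}^d\times\Theta\to\mathbb{R}^d$ and $F=(F_1,\dots,F_k):\mathbb{R}^d\times\Theta\to\mathbb{R}^{d\times k}$ satisfy, for some $L>0$, $$\sup_{i=0,\dots,k}|F_i(x_1,\theta_1)-F_i(x_2,\theta_2)|_2\le L\big(|x_1-x_2|_2+|x_1+x_2|_2\,|\theta_1-\theta_2|_2\big)$$ for all $(x_1,\theta_1),(x_2,\theta_2)\in\mathbb{R}^d\times\Theta$, let $x_0:\Theta\to\mathbb{R}^d$ be continuous, let $a:\mathbb{R}^d\times\Theta\to[0,\infty)$ be continuous, and let $f:[0,T]\times\mathbb{R}^k\to\mathbb{R}$ be such that: (i) $f(\cdot,w)$ is measurable for every $w\in\mathbb{R}^k$; (ii) $f(t,\cdot)$ is continuous and convex for a.e. $t\in[0,T]$; (iii) there are a non-negative $c\in L^1([0,T])$ and $C>0$ with $f(t,w)\ge C|w|_2^p-c(t)$ for a.e. $t\in[0,T]$ and every $w\in\mathbb{R}^k$;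 (iv) there are $w'\in\mathbb{R}^k$ and a non-negative $c'\in L^1([0,T])$ with $|f(t,w')|\le c'(t)$ for a.e. $t\in[0,T]$. For $u\in\mathcal{U}$ and $\theta\in\Theta$ let $x_u^\theta:[0,T]\to\mathbb{R}^d$ be the Carathéodory solution of $\dot x=F_0(x,\theta)+F(x,\theta)u(t)$ a.e. in $[0,T]$, $x(0)=x_0(\theta)$. Let $\Theta^N\subseteq\Theta$, $N\in\mathbb{N}\cup\{\infty\}$, be non-empty compact sets whose Hausdorff distances satisfy $d_H(\Theta^N,\Theta^\infty)\to0$ as $N\to\infty$, and set $$\mathcal{J}^N(u):=\max_{\theta\in\Theta^N}a(x_u^\theta(T),\theta)+\int_0^Tf(t,u(t))\,dt\in\mathbb{R}\cup\{+\infty\},\qquad u\in\mathcal{U},\ N\in\mathbb{N}\cup\{\infty\}.$$ Then these objects are well defined: for all $u\in\mathcal{U}$ and $\theta\in\Theta$ the solution $x_u^\theta$ exists and is unique, and for every non-empty compact $S\subseteq\Theta$ the maximum over $S$ is attained and the resulting functional does not take the value $-\infty$. Moreover, there is $\rho>0$ such that $$\text{for every }N\in\mathbb{N}\cup\{\infty\},\text{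 every minimizer }u\text{ of }\mathcal{J}^N\text{ over }\mathcal{U}\text{ satisfies }\|u\|_{L^p}\le\rho,\qquad(\ast)$$ and for every $\rho>0$ with the property $(\ast)$ the following holds, where $\mathcal{X}:=\{u\in\mathcal{U}:\|u\|_{L^p}\le\rho\}$ carries the weak topology of $L^p$ and $\mathcal{J}^N$ is restricted to $\mathcal{X}$. (a) $\mathcal{J}^N$ $\Gamma$-converges to $\mathcal{J}^\infty$ on $\mathcal{X}$: if $u_N\to u$ in $\mathcal{X}$, then $\mathcal{J}^\infty(u)\le\liminf_{N\to\infty}\mathcal{J}^N(u_N)$, and for every $u\in\mathcal{X}$ there is a sequence $u_N\to u$ in $\mathcal{X}$ with $\limsup_{N\to\infty}\mathcal{J}^N(u_N)\le\mathcal{J}^\infty(u)$. (b) $\lim_{N\to\infty}\inf_{\mathcal{X}}\mathcal{J}^N=\inf_{\mathcal{X}}\mathcal{J}^\infty$. (c) If $u_N^*\in\mathcal{X}$ is a minimizer of $\mathcal{J}^N$ over $\mathcal{X}$ for every $N\in\mathbb{N}$, then the sequence $(u_N^*)_{N\in\mathbb{N}}$ is pre-compact in the weak topology of $L^p$, and every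 limit point of it is a minimizer of $\mathcal{J}^\infty$ over $\mathcal{X}$. -/

import Mathlib

open MeasureTheory Filter Topology
open scoped ENNReal

namespace MinimaxEnsemble

noncomputable section

/-- `ℝⁿ` with its Euclidean norm. -/
abbrev Vec (n : ℕ) := EuclideanSpace ℝ (Fin n)

/-- Lebesgue measure on the time interval `[0, T]`. -/
abbrev timeMeasure (T : ℝ) : Measure ℝ := volume.restrict (Set.Icc 0 T)

/-- The space of controls `L^p([0, T], ℝᵏ)`. -/
abbrev Control (T : ℝ) (k : ℕ) (p : ℝ≥0∞) := Lp (Vec k) p (timeMeasure T)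

variable {d k l : ℕ}

/-- Standing hypothesis on the drift `F₀` and on the controlled fields `F = (F₁, …, F_k)`. -/
def LipschitzFields (Θ : Set (Vec l)) (F₀ : Vec d → Vec l → Vec d)
    (F : Vec d → Vec l → Fin k → Vec d) : Prop :=
  ∃ L : ℝ, 0 < L ∧ ∀ x₁ x₂ : Vec d, ∀ θ₁ ∈ Θ, ∀ θ₂ ∈ Θ,
    ‖F₀ x₁ θ₁ - F₀ x₂ θ₂‖ ≤ L * (‖x₁ - x₂‖ + ‖x₁ + x₂‖ * ‖θ₁ - θ₂‖) ∧
    ∀ i, ‖F x₁ θ₁ i - F x₂ θ₂ i‖ ≤ L * (‖x₁ - x₂‖ + ‖x₁ + x₂‖ * ‖θ₁ - θ₂‖)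

/-- Hypothesis on the terminal cost `a : ℝᵈ × Θ → ℝ₊`: continuous and non-negative. -/
structure TerminalCost (Θ : Set (Vec l)) (a : Vec d → Vec l → ℝ) : Prop where
  continuousOn : ContinuousOn (fun z : Vec d × Vec l => a z.1 z.2) (Set.univ ×ˢ Θ)
  nonneg : ∀ x, ∀ θ ∈ Θ, 0 ≤ a x θ

/-- Hypotheses on the running cost `f : [0, T] × ℝᵏ → ℝ`, for the exponent `p`.
`AEMeasurable` with respect to Lebesgue measure on `[0, T]` is Lebesgue measurability. -/
structure RunningCost (T : ℝ) (p : ℝ≥0∞) (f : ℝ → Vec k → ℝ) : Prop where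
  measurable : ∀ w, AEMeasurable (fun t => f t w) (timeMeasure T)
  continuous : ∀ᵐ t ∂timeMeasure T, Continuous (f t)
  convex : ∀ᵐ t ∂timeMeasure T, ConvexOn ℝ Set.univ (f t)
  growth : ∃ (c : ℝ → ℝ) (C : ℝ), Integrable c (timeMeasure T) ∧
    (∀ᵐ t ∂timeMeasure T, 0 ≤ c t) ∧ 0 < C ∧
    ∀ᵐ t ∂timeMeasure T, ∀ w, C * ‖w‖ ^ p.toReal - c t ≤ f t w
  finite : ∃ (w' : Vec k) (c' : ℝ → ℝ), Integrable c' (timeMeasure T) ∧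
    (∀ᵐ t ∂timeMeasure T, 0 ≤ c' t) ∧ ∀ᵐ t ∂timeMeasure T, |f t w'| ≤ c' t

/-- `x` is on `[0, T]` a Carathéodory solution of
`x' = F₀(x, θ) + ∑ᵢ uᵢ Fᵢ(x, θ)`, `x(0) = x₀(θ)`: it is continuous, and the equation holds in
integrated form (so `x` is absolutely continuous and the equation holds almost everywhere). -/
structure IsTrajectory (T : ℝ) (F₀ : Vec d → Vec l → Vec d) (F : Vec d → Vec l → Fin k → Vec d)
    (x₀ : Vec l → Vec d) (u : ℝ → Vec k) (θ : Vec l) (x : ℝ → Vec d) : Prop where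
  continuousOn : ContinuousOn x (Set.Icc 0 T)
  intervalIntegrable :
    IntervalIntegrable (fun s => F₀ (x s) θ + ∑ i, u s i • F (x s) θ i) volume 0 T
  eq_integral : ∀ t ∈ Set.Icc 0 T,
    x t = x₀ θ + ∫ s in (0 : ℝ)..t, (F₀ (x s) θ + ∑ i, u s i • F (x s) θ i)

open Classical in
/-- The trajectory `x_u^θ` (a chosen solution; the value is `0` if there is none). -/
def trajectory (T : ℝ) (F₀ : Vec d → Vec l → Vec d) (F : Vec d → Vec l → Fin k → Vec d)
    (x₀ : Vec l → Vec d) (u : ℝ → Vec k) (θ : Vec l) : ℝ → Vec d :=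
  if h : ∃ x, IsTrajectory T F₀ F x₀ u θ x then h.choose else 0

/-- The integral of a real function as an extended real number, namely the integral of the positive
part minus the integral of the negative part. -/
def extIntegral (μ : Measure ℝ) (g : ℝ → ℝ) : EReal :=
  ((∫⁻ t, ENNReal.ofReal (g t) ∂μ : ℝ≥0∞) : EReal)
    - ((∫⁻ t, ENNReal.ofReal (-g t) ∂μ : ℝ≥0∞) : EReal)

/-- The minimax functional
`J(u) = max_{θ ∈ S} a(x_u^θ(T), θ) + ∫₀ᵀ f(t, u(t)) dt` over the set of parameters `S`. -/
def minimaxCost {p : ℝ≥0∞} (T : ℝ) (F₀ : Vec d → Vec l → Vec d)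
    (F : Vec d → Vec l → Fin k → Vec d) (x₀ : Vec l → Vec d) (a : Vec d → Vec l → ℝ)
    (f : ℝ → Vec k → ℝ) (S : Set (Vec l)) (u : Control T k p) : EReal :=
  (⨆ θ ∈ S, (a (trajectory T F₀ F x₀ u θ T) θ : EReal))
    + extIntegral (timeMeasure T) (fun t => f t (u t))

/-- `v` is a (global) minimizer of `G`. -/
def IsMinimizer {X : Type*} (G : X → EReal) (v : X) : Prop := ∀ w, G v ≤ G w

/-- The closed ball of radius `ρ` in `L^p([0, T], ℝᵏ)`, as a set in `L^p` with its weak topology. -/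
def weakBall (T : ℝ) (k : ℕ) (p : ℝ≥0∞) [Fact (1 ≤ p)] (ρ : ℝ) :
    Set (WeakSpace ℝ (Control T k p)) :=
  {u | ‖(toWeakSpace ℝ (Control T k p)).symm u‖ ≤ ρ}

/-- The restriction of a functional on `L^p` to the closed ball of radius `ρ`. -/
def restrictBall {T : ℝ} {p : ℝ≥0∞} [Fact (1 ≤ p)] (ρ : ℝ)
    (J : Control T k p → EReal) (u : weakBall T k p ρ) : EReal :=
  J ((toWeakSpace ℝ (Control T k p)).symm u.1)

/-- (Sequential) `Γ`-convergence of the functionals `G N` to `G'`. -/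
structure GammaConverges {X : Type*} [TopologicalSpace X]
    (G : ℕ → X → EReal) (G' : X → EReal) : Prop where
  liminf_le : ∀ (u : ℕ → X) (v : X), Tendsto u atTop (𝓝 v) →
    G' v ≤ liminf (fun N => G N (u N)) atTop
  limsup_le : ∀ v : X, ∃ u : ℕ → X, Tendsto u atTop (𝓝 v) ∧
    limsup (fun N => G N (u N)) atTop ≤ G' v

end

end MinimaxEnsemble

/-
The direct method of the calculus of variations. As `1 < p`, Hölder's inequality gives the
primitives of `F(x_u^θ, θ) u_N` a common modulus of continuity when `u_N` is bounded in `L^p`.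
By the Arzelà–Ascoli theorem they converge uniformly when `u_N` converges weakly, and Grönwall's
lemma carries this over to the trajectories: `(θ, u) ↦ a(x_u^θ(T), θ)` is continuous on `Θ`
times a ball of `L^p` with its weak topology. This ball is compact because `L^p` is uniformly
convex. Hence the terminal cost is equicontinuous in `θ`, and Hausdorff convergence of the
parameter sets makes the functionals converge uniformly on the ball. The limit is weakly lower
semicontinuous since the running cost is convex, and uniform convergence to a lower
semicontinuous limit yields `Γ`-convergence and the convergence of minima and minimizers.
Coercivity of the running cost bounds the minimizers, uniformly in the set of parameters.
-/

namespace MinimaxEnsemble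

section IntegralEquations

variable {E : Type*} [NormedAddCommGroup E] {a b : ℝ} {β : ℝ → ℝ}

lemma intervalIntegrable_of_mem_Icc {g : ℝ → E} (hg : IntervalIntegrable g volume a b) {s t : ℝ}
    (hs : s ∈ Set.Icc a b) (ht : t ∈ Set.Icc a b) : IntervalIntegrable g volume s t :=
  hg.mono_set (Set.uIcc_subset_uIcc (Set.Icc_subset_uIcc hs) (Set.Icc_subset_uIcc ht))

lemma continuousOn_exp_integral (hab : a ≤ b) (hint : IntervalIntegrable β volume a b) :
    ContinuousOn (fun t => Real.exp (∫ s in a..t, β s)) (Set.Icc a b) :=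
  Real.continuous_exp.comp_continuousOn
    (Set.uIcc_of_le hab ▸ intervalIntegral.continuousOn_primitive_interval' hint Set.left_mem_uIcc)

lemma integral_mul_exp_integral_le (hβ : ∀ s, 0 ≤ β s) (hab : a ≤ b)
    (hint : IntervalIntegrable β volume a b) :
    ∫ s in a..b, β s * Real.exp (∫ r in a..s, β r) ≤ Real.exp (∫ r in a..b, β r) - 1 := by
  set g : ℝ → ℝ := fun s => Real.exp (∫ r in a..s, β r) with hg
  have hmono : MonotoneOn g (Set.uIcc a b) := by
    rw [Set.uIcc_of_le hab]
    intro s hs t ht hst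
    have hadd := intervalIntegral.integral_add_adjacent_intervals
      (intervalIntegrable_of_mem_Icc hint (Set.left_mem_Icc.2 hab) hs)
      (intervalIntegrable_of_mem_Icc hint hs ht)
    exact Real.exp_le_exp.2
      (hadd ▸ le_add_of_nonneg_right (intervalIntegral.integral_nonneg hst fun _ _ => hβ _))
  have hderiv : ∫ s in a..b, deriv g s = ∫ s in a..b, β s * g s := by
    apply intervalIntegral.integral_congr_ae
    filter_upwards [hint.ae_hasDerivAt_integral] with s hs hsI
    rw [(hs (Set.uIoc_subset_uIcc hsI) a Set.left_mem_uIcc).exp.deriv, mul_comm]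
  have hle : g a ≤ g b := hmono Set.left_mem_uIcc Set.right_mem_uIcc hab
  have hmem := hmono.intervalIntegral_deriv_mem_uIcc
  rw [Set.uIcc_of_le (sub_nonneg.2 hle), hderiv] at hmem
  simpa [hg] using hmem.2

theorem gronwall_le_mul_exp_integral (hβ : ∀ s, 0 ≤ β s)
    (hint : IntervalIntegrable β volume a b) {φ : ℝ → ℝ} (hφ : ContinuousOn φ (Set.Icc a b))
    (hφ0 : ∀ t ∈ Set.Icc a b, 0 ≤ φ t) {A : ℝ}
    (hle : ∀ t ∈ Set.Icc a b, φ t ≤ A + ∫ s in a..t, β s * φ s) {t : ℝ} (ht : t ∈ Set.Icc a b) :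
    φ t ≤ A * Real.exp (∫ s in a..t, β s) := by
  have hab : a ≤ b := ht.1.trans ht.2
  set w : ℝ → ℝ := fun t => Real.exp (∫ s in a..t, β s)
  have hwc : ContinuousOn w (Set.Icc a b) := continuousOn_exp_integral hab hint
  have hw0 : ∀ t, 0 < w t := fun t => Real.exp_pos _
  obtain ⟨t₀, ht₀, hmax⟩ := isCompact_Icc.exists_isMaxOn ⟨t, ht⟩
    (hφ.div hwc fun s _ => (hw0 s).ne')
  set M := φ t₀ / w t₀
  have hφM : ∀ s ∈ Set.Icc a b, φ s ≤ M * w s := fun s hs => (div_le_iff₀ (hw0 s)).1 (hmax hs)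
  have hint₀ := intervalIntegrable_of_mem_Icc hint (Set.left_mem_Icc.2 hab) ht₀
  have hsub : Set.uIcc a t₀ ⊆ Set.Icc a b :=
    Set.uIcc_of_le ht₀.1 ▸ Set.Icc_subset_Icc le_rfl ht₀.2
  have hM0 : 0 ≤ M := div_nonneg (hφ0 _ ht₀) (hw0 _).le
  have hMA : M * w t₀ ≤ A + M * (w t₀ - 1) := calc
    M * w t₀ = φ t₀ := div_mul_cancel₀ _ (hw0 t₀).ne'
    _ ≤ A + ∫ s in a..t₀, β s * φ s := hle t₀ ht₀
    _ ≤ A + ∫ s in a..t₀, M * (β s * w s) := by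
      gcongr
      refine intervalIntegral.integral_mono_on ht₀.1 (hint₀.mul_continuousOn (hφ.mono hsub))
        ((hint₀.mul_continuousOn (hwc.mono hsub)).const_mul M) fun s hs => ?_
      rw [mul_left_comm]
      exact mul_le_mul_of_nonneg_left (hφM s ⟨hs.1, hs.2.trans ht₀.2⟩) (hβ s)
    _ ≤ A + M * (w t₀ - 1) := by
      rw [intervalIntegral.integral_const_mul]
      gcongr
      exact integral_mul_exp_integral_le hβ ht₀.1 hint₀
  exact (hφM t ht).trans (mul_le_mul_of_nonneg_right (by linarith) (hw0 t).le)

variable [NormedSpace ℝ E] {g : ℝ → E → E}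

theorem norm_sub_le_mul_exp_integral (hβ : ∀ s, 0 ≤ β s) (hint : IntervalIntegrable β volume a b)
    (hg : ∀ s x y, ‖g s x - g s y‖ ≤ β s * ‖x - y‖) {x y : ℝ → E}
    (hx : ContinuousOn x (Set.Icc a b)) (hy : ContinuousOn y (Set.Icc a b)) {A : ℝ}
    (hA : ∀ t ∈ Set.Icc a b, ‖x t - y t - ∫ s in a..t, (g s (x s) - g s (y s))‖ ≤ A) {t : ℝ}
    (ht : t ∈ Set.Icc a b) : ‖x t - y t‖ ≤ A * Real.exp (∫ s in a..t, β s) := by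
  refine gronwall_le_mul_exp_integral (φ := fun s => ‖x s - y s‖) hβ hint
    (hx.sub hy).norm (fun _ _ => norm_nonneg _) (fun t ht => ?_) ht
  have hsub : Set.uIcc a t ⊆ Set.Icc a b :=
    Set.uIcc_of_le ht.1 ▸ Set.Icc_subset_Icc le_rfl ht.2
  have hle : ‖∫ s in a..t, (g s (x s) - g s (y s))‖ ≤ ∫ s in a..t, β s * ‖x s - y s‖ :=
    intervalIntegral.norm_integral_le_of_norm_le ht.1 (ae_of_all _ fun s _ => hg s _ _)
      ((intervalIntegrable_of_mem_Icc hint (Set.left_mem_Icc.2 (ht.1.trans ht.2))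
        ht).mul_continuousOn ((hx.sub hy).norm.mono hsub))
  calc ‖x t - y t‖
      ≤ ‖x t - y t - ∫ s in a..t, (g s (x s) - g s (y s))‖
        + ‖∫ s in a..t, (g s (x s) - g s (y s))‖ := norm_le_norm_sub_add _ _
    _ ≤ A + ∫ s in a..t, β s * ‖x s - y s‖ := add_le_add (hA t ht) hle

/-- The curve `s ↦ exp (∫ₐˢ β) • y s` on `[a, b]`, extended to `ℝ` by its end values. In this
coordinate the Picard operator is a contraction for the supremum norm of `y`. -/
noncomputable def weightedCurve (hab : a ≤ b) (hβ : IntervalIntegrable β volume a b)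
    (y : C(Set.Icc a b, E)) : C(ℝ, E) where
  toFun := Set.IccExtend hab fun s : Set.Icc a b => Real.exp (∫ r in a..s, β r) • y s
  continuous_toFun :=
    ((continuousOn_exp_integral hab hβ).domRestrict.smul y.continuous).Icc_extend'

lemma weightedCurve_apply (hab : a ≤ b) (hβ : IntervalIntegrable β volume a b)
    (y : C(Set.Icc a b, E)) {s : ℝ} (hs : s ∈ Set.Icc a b) :
    weightedCurve hab hβ y s = Real.exp (∫ r in a..s, β r) • y ⟨s, hs⟩ :=
  Set.IccExtend_of_mem hab (fun s : Set.Icc a b => Real.exp (∫ r in a..s, β r) • y s) hs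

/-- The Picard operator of the integral equation `x t = x₀ + ∫ₐᵗ g s (x s)`, in the coordinate `y`
of `x = weightedCurve hab hβ y`. -/
noncomputable def weightedPicard (hab : a ≤ b) (hβ : IntervalIntegrable β volume a b)
    (hg : ∀ x : C(ℝ, E), IntervalIntegrable (fun s => g s (x s)) volume a b) (x₀ : E)
    (y : C(Set.Icc a b, E)) : C(Set.Icc a b, E) where
  toFun t := (Real.exp (∫ r in a..t, β r))⁻¹ •
    (x₀ + ∫ s in a..t, g s (weightedCurve hab hβ y s))
  continuous_toFun := by
    have hw : Continuous fun t : Set.Icc a b => Real.exp (∫ r in a..t, β r) :=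
      (continuousOn_exp_integral hab hβ).domRestrict
    have hx : Continuous fun t : Set.Icc a b => ∫ s in a..t, g s (weightedCurve hab hβ y s) :=
      (Set.uIcc_of_le hab ▸ intervalIntegral.continuousOn_primitive_interval'
        (hg (weightedCurve hab hβ y)) Set.left_mem_uIcc).domRestrict
    exact (hw.inv₀ fun _ => (Real.exp_pos _).ne').smul (continuous_const.add hx)

lemma weightedPicard_apply (hab : a ≤ b) (hβ : IntervalIntegrable β volume a b)
    (hg : ∀ x : C(ℝ, E), IntervalIntegrable (fun s => g s (x s)) volume a b) (x₀ : E)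
    (y : C(Set.Icc a b, E)) (t : Set.Icc a b) :
    weightedPicard hab hβ hg x₀ y t = (Real.exp (∫ r in a..t, β r))⁻¹ •
      (x₀ + ∫ s in a..t, g s (weightedCurve hab hβ y s)) :=
  rfl

lemma norm_integral_weightedCurve_sub_le (hab : a ≤ b) (hβ0 : ∀ s, 0 ≤ β s)
    (hβ : IntervalIntegrable β volume a b) (hlip : ∀ s x y, ‖g s x - g s y‖ ≤ β s * ‖x - y‖)
    (y z : C(Set.Icc a b, E)) {t : ℝ} (ht : t ∈ Set.Icc a b) :
    ‖∫ s in a..t, (g s (weightedCurve hab hβ y s) - g s (weightedCurve hab hβ z s))‖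
      ≤ dist y z * (Real.exp (∫ r in a..t, β r) - 1) := by
  have hsub : Set.uIcc a t ⊆ Set.Icc a b :=
    Set.uIcc_of_le ht.1 ▸ Set.Icc_subset_Icc le_rfl ht.2
  have hβt := intervalIntegrable_of_mem_Icc hβ (Set.left_mem_Icc.2 hab) ht
  have hpointwise : ∀ s ∈ Set.Ioc a t,
      ‖g s (weightedCurve hab hβ y s) - g s (weightedCurve hab hβ z s)‖
        ≤ dist y z * (β s * Real.exp (∫ r in a..s, β r)) := fun s hs => by
    have hs' : s ∈ Set.Icc a b := ⟨hs.1.le, hs.2.trans ht.2⟩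
    refine (hlip s _ _).trans ?_
    rw [weightedCurve_apply hab hβ y hs', weightedCurve_apply hab hβ z hs', ← smul_sub, norm_smul,
      Real.norm_eq_abs, Real.abs_exp, ← dist_eq_norm, ← mul_assoc, mul_comm (dist y z)]
    exact mul_le_mul_of_nonneg_left (ContinuousMap.dist_apply_le_dist _)
      (mul_nonneg (hβ0 s) (Real.exp_nonneg _))
  refine (intervalIntegral.norm_integral_le_of_norm_le ht.1 (ae_of_all _ hpointwise)
    ((hβt.mul_continuousOn ((continuousOn_exp_integral hab hβ).mono hsub)).const_mul _)).trans ?_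
  rw [intervalIntegral.integral_const_mul]
  exact mul_le_mul_of_nonneg_left (integral_mul_exp_integral_le hβ0 ht.1 hβt) dist_nonneg

lemma dist_weightedPicard_le (hab : a ≤ b) (hβ0 : ∀ s, 0 ≤ β s)
    (hβ : IntervalIntegrable β volume a b)
    (hg : ∀ x : C(ℝ, E), IntervalIntegrable (fun s => g s (x s)) volume a b)
    (hlip : ∀ s x y, ‖g s x - g s y‖ ≤ β s * ‖x - y‖) (x₀ : E) (y z : C(Set.Icc a b, E)) :
    dist (weightedPicard hab hβ hg x₀ y) (weightedPicard hab hβ hg x₀ z)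
      ≤ (1 - (Real.exp (∫ r in a..b, β r))⁻¹) * dist y z := by
  have hone : (Real.exp (∫ r in a..b, β r))⁻¹ ≤ 1 :=
    inv_le_one_of_one_le₀ (Real.one_le_exp (intervalIntegral.integral_nonneg hab fun s _ => hβ0 s))
  refine (ContinuousMap.dist_le (mul_nonneg (sub_nonneg.2 hone) dist_nonneg)).2 fun ⟨t, ht⟩ => ?_
  have hgt := fun y => intervalIntegrable_of_mem_Icc (hg (weightedCurve hab hβ y))
    (Set.left_mem_Icc.2 hab) ht
  have hmono : ∫ r in a..t, β r ≤ ∫ r in a..b, β r :=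
    intervalIntegral.integral_mono_interval le_rfl ht.1 ht.2 (ae_of_all _ hβ0) hβ
  calc dist (weightedPicard hab hβ hg x₀ y ⟨t, ht⟩) (weightedPicard hab hβ hg x₀ z ⟨t, ht⟩)
      = (Real.exp (∫ r in a..t, β r))⁻¹ *
          ‖∫ s in a..t, (g s (weightedCurve hab hβ y s) - g s (weightedCurve hab hβ z s))‖ := by
        rw [weightedPicard_apply, weightedPicard_apply, dist_eq_norm, ← smul_sub, norm_smul,
          norm_inv, Real.norm_eq_abs, Real.abs_exp, add_sub_add_left_eq_sub,
          intervalIntegral.integral_sub (hgt y) (hgt z)]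
    _ ≤ (Real.exp (∫ r in a..t, β r))⁻¹ * (dist y z * (Real.exp (∫ r in a..t, β r) - 1)) := by
        gcongr
        exact norm_integral_weightedCurve_sub_le hab hβ0 hβ hlip y z ht
    _ = (1 - (Real.exp (∫ r in a..t, β r))⁻¹) * dist y z := by field_simp
    _ ≤ (1 - (Real.exp (∫ r in a..b, β r))⁻¹) * dist y z := by gcongr

theorem exists_eq_add_integral_of_norm_sub_le [CompleteSpace E] (hab : a ≤ b) (hβ0 : ∀ s, 0 ≤ β s)
    (hβ : IntervalIntegrable β volume a b)
    (hg : ∀ x : C(ℝ, E), IntervalIntegrable (fun s => g s (x s)) volume a b)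
    (hlip : ∀ s x y, ‖g s x - g s y‖ ≤ β s * ‖x - y‖) (x₀ : E) :
    ∃ x : C(ℝ, E), ∀ t ∈ Set.Icc a b, x t = x₀ + ∫ s in a..t, g s (x s) := by
  have hcontract : ContractingWith (1 - (Real.exp (∫ r in a..b, β r))⁻¹).toNNReal
      (weightedPicard hab hβ hg x₀) := by
    refine ⟨by simp [Real.exp_pos], LipschitzWith.of_dist_le_mul fun y z => ?_⟩
    exact (dist_weightedPicard_le hab hβ0 hβ hg hlip x₀ y z).trans
      (mul_le_mul_of_nonneg_right (Real.le_coe_toNNReal _) dist_nonneg)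
  obtain ⟨y, hy, -⟩ := hcontract.exists_fixedPoint 0 (edist_ne_top _ _)
  refine ⟨weightedCurve hab hβ y, fun t ht => ?_⟩
  have hyt := DFunLike.congr_fun (show weightedPicard hab hβ hg x₀ y = y from hy) ⟨t, ht⟩
  rw [weightedCurve_apply hab hβ y ht, ← hyt, weightedPicard_apply,
    smul_inv_smul₀ (Real.exp_pos _).ne']

end IntegralEquations

section Trajectories

lemma intervalIntegrable_clm_apply {V E : Type*} [NormedAddCommGroup V] [NormedSpace ℝ V]
    [NormedAddCommGroup E] [NormedSpace ℝ E] {a b : ℝ} {A : ℝ → V →L[ℝ] E} {v : ℝ → V}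
    (hA : ContinuousOn A (Set.uIcc a b)) (hv : IntervalIntegrable v volume a b) :
    IntervalIntegrable (fun s => A s (v s)) volume a b := by
  obtain ⟨C, hC⟩ := isCompact_uIcc.exists_bound_of_continuousOn hA
  rw [intervalIntegrable_iff] at hv ⊢
  have hAm : AEStronglyMeasurable A (volume.restrict (Set.uIoc a b)) :=
    (hA.mono Set.uIoc_subset_uIcc).aestronglyMeasurable measurableSet_uIoc
  refine (hv.norm.const_mul C).mono' ((ContinuousLinearMap.id ℝ
    (V →L[ℝ] E)).aestronglyMeasurable_comp₂ hAm hv.aestronglyMeasurable) ?_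
  filter_upwards [ae_restrict_mem measurableSet_uIoc] with s hs
  exact (A s).le_of_opNorm_le (hC s (Set.uIoc_subset_uIcc hs)) _

variable {d k l : ℕ}

/-- The right-hand side `F₀(x, θ) + F(x, θ) w` of the control system. -/
def velocity (F₀ : Vec d → Vec l → Vec d) (F : Vec d → Vec l → Fin k → Vec d) (θ : Vec l)
    (x : Vec d) (w : Vec k) : Vec d :=
  F₀ x θ + ∑ i, w i • F x θ i

/-- The matrix `F(x, θ) = (F₁(x, θ), …, F_k(x, θ))` as a linear map. -/
noncomputable def controlMap (F : Vec d → Vec l → Fin k → Vec d) (θ : Vec l) (x : Vec d) :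
    Vec k →L[ℝ] Vec d :=
  ∑ i, (EuclideanSpace.proj (𝕜 := ℝ) i).smulRight (F x θ i)

lemma velocity_eq_add_controlMap (F₀ : Vec d → Vec l → Vec d) (F : Vec d → Vec l → Fin k → Vec d)
    (θ : Vec l) (x : Vec d) (w : Vec k) :
    velocity F₀ F θ x w = F₀ x θ + controlMap F θ x w := by
  simp [velocity, controlMap]

variable {T : ℝ} {Θ : Set (Vec l)} {F₀ : Vec d → Vec l → Vec d}
  {F : Vec d → Vec l → Fin k → Vec d} {x₀ : Vec l → Vec d} {θ : Vec l}

lemma LipschitzFields.exists_norm_velocity_sub_le (hF : LipschitzFields Θ F₀ F) :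
    ∃ L : ℝ, 0 ≤ L ∧ ∀ θ₁ ∈ Θ, ∀ θ₂ ∈ Θ, ∀ x₁ x₂ : Vec d, ∀ w : Vec k,
      ‖velocity F₀ F θ₁ x₁ w - velocity F₀ F θ₂ x₂ w‖
        ≤ L * (1 + ‖w‖) * (‖x₁ - x₂‖ + ‖x₁ + x₂‖ * ‖θ₁ - θ₂‖) := by
  obtain ⟨L, hL0, hL⟩ := hF
  refine ⟨L * (1 + k), by positivity, fun θ₁ hθ₁ θ₂ hθ₂ x₁ x₂ w => ?_⟩
  obtain ⟨hdrift, hfields⟩ := hL x₁ x₂ θ₁ hθ₁ θ₂ hθ₂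
  set D := ‖x₁ - x₂‖ + ‖x₁ + x₂‖ * ‖θ₁ - θ₂‖
  have hD0 : 0 ≤ D := by positivity
  have hsum : ‖∑ i, w i • (F x₁ θ₁ i - F x₂ θ₂ i)‖ ≤ k * (‖w‖ * (L * D)) := by
    refine (norm_sum_le_of_le (f := fun i => w i • (F x₁ θ₁ i - F x₂ θ₂ i)) Finset.univ
      fun i _ => ?_).trans_eq (b := ∑ _i : Fin k, ‖w‖ * (L * D)) (by simp)
    rw [norm_smul]
    exact mul_le_mul (PiLp.norm_apply_le w i) (hfields i) (norm_nonneg _) (norm_nonneg _)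
  calc ‖velocity F₀ F θ₁ x₁ w - velocity F₀ F θ₂ x₂ w‖
      = ‖(F₀ x₁ θ₁ - F₀ x₂ θ₂) + ∑ i, w i • (F x₁ θ₁ i - F x₂ θ₂ i)‖ := by
        simp only [velocity, smul_sub, Finset.sum_sub_distrib]
        congr 1; abel
    _ ≤ L * D + k * (‖w‖ * (L * D)) := norm_add_le_of_le hdrift hsum
    _ ≤ L * (1 + k) * (1 + ‖w‖) * D := by
        have := mul_nonneg hL0.le hD0
        nlinarith [mul_nonneg (norm_nonneg w) this, mul_nonneg (Nat.cast_nonneg (α := ℝ) k) this]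

lemma continuous_of_norm_sub_le {X Y : Type*} [NormedAddCommGroup X] [NormedAddCommGroup Y]
    {f : X → Y} {L : ℝ} (h : ∀ x y, ‖f x - f y‖ ≤ L * ‖x - y‖) : Continuous f :=
  (LipschitzWith.of_dist_le' (K := L) fun x y => by
    simpa only [dist_eq_norm] using h x y).continuous

lemma LipschitzFields.continuous_drift (hF : LipschitzFields Θ F₀ F) (hθ : θ ∈ Θ) :
    Continuous fun x => F₀ x θ := by
  obtain ⟨L, -, hL⟩ := hF
  exact continuous_of_norm_sub_le fun x y => by simpa using (hL x y θ hθ θ hθ).1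

lemma LipschitzFields.continuous_controlMap (hF : LipschitzFields Θ F₀ F) (hθ : θ ∈ Θ) :
    Continuous (controlMap F θ) := by
  obtain ⟨L, -, hL⟩ := hF
  refine continuous_finsetSum _ fun i _ => ?_
  have hFi : Continuous fun x => F x θ i :=
    continuous_of_norm_sub_le fun x y => by simpa using (hL x y θ hθ θ hθ).2 i
  exact (ContinuousLinearMap.smulRightL ℝ (Vec k) (Vec d) (EuclideanSpace.proj i)).continuous.comp
    hFi

lemma LipschitzFields.intervalIntegrable_velocity (hF : LipschitzFields Θ F₀ F) (hθ : θ ∈ Θ)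
    {a b : ℝ} {u : ℝ → Vec k} (hu : IntervalIntegrable u volume a b) {x : ℝ → Vec d}
    (hx : ContinuousOn x (Set.uIcc a b)) :
    IntervalIntegrable (fun s => velocity F₀ F θ (x s) (u s)) volume a b := by
  simp only [velocity_eq_add_controlMap]
  exact ((hF.continuous_drift hθ).comp_continuousOn hx).intervalIntegrable.add
    (intervalIntegrable_clm_apply ((hF.continuous_controlMap hθ).comp_continuousOn hx) hu)

theorem LipschitzFields.exists_isTrajectory (hF : LipschitzFields Θ F₀ F) (hT : 0 ≤ T)
    (hθ : θ ∈ Θ) {u : ℝ → Vec k} (hu : IntervalIntegrable u volume 0 T) (x₀ : Vec l → Vec d) :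
    ∃ x, IsTrajectory T F₀ F x₀ u θ x := by
  obtain ⟨L, hL0, hL⟩ := hF.exists_norm_velocity_sub_le
  have hint : ∀ x : C(ℝ, Vec d),
      IntervalIntegrable (fun s => velocity F₀ F θ (x s) (u s)) volume 0 T :=
    fun x => hF.intervalIntegrable_velocity hθ hu x.continuous.continuousOn
  obtain ⟨x, hx⟩ := exists_eq_add_integral_of_norm_sub_le (β := fun s => L * (1 + ‖u s‖)) hT
    (fun s => by positivity) ((intervalIntegrable_const.add hu.norm).const_mul L) hint
    (fun s x y => by simpa using hL θ hθ θ hθ x y (u s)) (x₀ θ)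
  exact ⟨x, x.continuous.continuousOn, hint x, hx⟩

lemma LipschitzFields.isTrajectory_trajectory (hF : LipschitzFields Θ F₀ F) (hT : 0 ≤ T)
    (hθ : θ ∈ Θ) {u : ℝ → Vec k} (hu : IntervalIntegrable u volume 0 T) (x₀ : Vec l → Vec d) :
    IsTrajectory T F₀ F x₀ u θ (trajectory T F₀ F x₀ u θ) := by
  have hex := hF.exists_isTrajectory hT hθ hu x₀
  rw [trajectory, dif_pos hex]
  exact hex.choose_spec

lemma IsTrajectory.sub_sub_integral_eq (hF : LipschitzFields Θ F₀ F) {θ₁ θ₂ : Vec l}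
    (hθ₁ : θ₁ ∈ Θ) (hθ₂ : θ₂ ∈ Θ) {u v : ℝ → Vec k} (hu : IntervalIntegrable u volume 0 T)
    (hv : IntervalIntegrable v volume 0 T) {x y : ℝ → Vec d}
    (hx : IsTrajectory T F₀ F x₀ u θ₁ x) (hy : IsTrajectory T F₀ F x₀ v θ₂ y) {t : ℝ}
    (ht : t ∈ Set.Icc 0 T) :
    y t - x t - ∫ s in (0 : ℝ)..t, (velocity F₀ F θ₂ (y s) (v s) - velocity F₀ F θ₂ (x s) (v s))
      = (x₀ θ₂ - x₀ θ₁)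
        + (∫ s in (0 : ℝ)..t, (velocity F₀ F θ₂ (x s) (v s) - velocity F₀ F θ₁ (x s) (v s)))
        + ((∫ s in (0 : ℝ)..t, controlMap F θ₁ (x s) (v s))
          - ∫ s in (0 : ℝ)..t, controlMap F θ₁ (x s) (u s)) := by
  have hsub : Set.uIcc 0 t ⊆ Set.Icc 0 T :=
    Set.uIcc_of_le ht.1 ▸ Set.Icc_subset_Icc le_rfl ht.2
  have h0 : (0 : ℝ) ∈ Set.Icc 0 T := Set.left_mem_Icc.2 (ht.1.trans ht.2)
  have hut := intervalIntegrable_of_mem_Icc hu h0 ht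
  have hvt := intervalIntegrable_of_mem_Icc hv h0 ht
  have hxt := hx.continuousOn.mono hsub
  have hyt := hy.continuousOn.mono hsub
  have hdrift := ((hF.continuous_drift hθ₁).comp_continuousOn hxt).intervalIntegrable
    (μ := volume)
  have hmap := (hF.continuous_controlMap hθ₁).comp_continuousOn hxt
  have hsplit : ∀ w : ℝ → Vec k, IntervalIntegrable w volume 0 t →
      ∫ s in (0 : ℝ)..t, velocity F₀ F θ₁ (x s) (w s)
        = (∫ s in (0 : ℝ)..t, F₀ (x s) θ₁) + ∫ s in (0 : ℝ)..t, controlMap F θ₁ (x s) (w s) := by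
    intro w hw
    simp only [velocity_eq_add_controlMap]
    exact intervalIntegral.integral_add hdrift (intervalIntegrable_clm_apply hmap hw)
  have hxeq : x t = x₀ θ₁ + ∫ s in (0 : ℝ)..t, velocity F₀ F θ₁ (x s) (u s) :=
    hx.eq_integral t ht
  have hyeq : y t = x₀ θ₂ + ∫ s in (0 : ℝ)..t, velocity F₀ F θ₂ (y s) (v s) :=
    hy.eq_integral t ht
  rw [hxeq, hyeq, intervalIntegral.integral_sub (hF.intervalIntegrable_velocity hθ₂ hvt hyt)
      (hF.intervalIntegrable_velocity hθ₂ hvt hxt),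
    intervalIntegral.integral_sub (hF.intervalIntegrable_velocity hθ₂ hvt hxt)
      (hF.intervalIntegrable_velocity hθ₁ hvt hxt), hsplit u hut, hsplit v hvt]
  abel

lemma norm_integral_velocity_sub_le {θ₁ θ₂ : Vec l} {L : ℝ} (hL0 : 0 ≤ L)
    (hL : ∀ (z : Vec d) (w : Vec k), ‖velocity F₀ F θ₂ z w - velocity F₀ F θ₁ z w‖
      ≤ L * (1 + ‖w‖) * (‖z + z‖ * ‖θ₂ - θ₁‖))
    {v : ℝ → Vec k} {t : ℝ} (ht : 0 ≤ t) (hv : IntervalIntegrable v volume 0 t)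
    {x : ℝ → Vec d} {C : ℝ} (hC : ∀ s ∈ Set.Icc 0 t, ‖x s‖ ≤ C) :
    ‖∫ s in (0 : ℝ)..t, (velocity F₀ F θ₂ (x s) (v s) - velocity F₀ F θ₁ (x s) (v s))‖
      ≤ 2 * C * ‖θ₂ - θ₁‖ * ∫ s in (0 : ℝ)..t, L * (1 + ‖v s‖) := by
  rw [← intervalIntegral.integral_const_mul]
  refine intervalIntegral.norm_integral_le_of_norm_le ht (ae_of_all _ fun s hs => ?_)
    (((intervalIntegrable_const.add hv.norm).const_mul L).const_mul _)
  have hxs := hC s ⟨hs.1.le, hs.2⟩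
  calc _ ≤ L * (1 + ‖v s‖) * (‖x s + x s‖ * ‖θ₂ - θ₁‖) := hL _ _
    _ ≤ L * (1 + ‖v s‖) * ((C + C) * ‖θ₂ - θ₁‖) := by gcongr; exact norm_add_le_of_le hxs hxs
    _ = 2 * C * ‖θ₂ - θ₁‖ * (L * (1 + ‖v s‖)) := by ring

/-- The controls enter only through the primitives of `F(x, θ₁) v` and `F(x, θ₁) u`, which converge
when `v` tends weakly to `u`. -/
theorem LipschitzFields.exists_norm_trajectory_sub_le (hF : LipschitzFields Θ F₀ F) :
    ∃ L : ℝ, 0 ≤ L ∧ ∀ θ₁ ∈ Θ, ∀ θ₂ ∈ Θ, ∀ u v : ℝ → Vec k, IntervalIntegrable u volume 0 T →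
      IntervalIntegrable v volume 0 T → ∀ x y : ℝ → Vec d, IsTrajectory T F₀ F x₀ u θ₁ x →
      IsTrajectory T F₀ F x₀ v θ₂ y → ∀ C K η : ℝ, (∀ t ∈ Set.Icc 0 T, ‖x t‖ ≤ C) →
      ∫ s in (0 : ℝ)..T, (1 + ‖v s‖) ≤ K →
      (∀ t ∈ Set.Icc 0 T, ‖(∫ s in (0 : ℝ)..t, controlMap F θ₁ (x s) (v s))
        - ∫ s in (0 : ℝ)..t, controlMap F θ₁ (x s) (u s)‖ ≤ η) → ∀ t ∈ Set.Icc 0 T,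
      ‖y t - x t‖
        ≤ (‖x₀ θ₂ - x₀ θ₁‖ + 2 * C * ‖θ₂ - θ₁‖ * (L * K) + η) * Real.exp (L * K) := by
  obtain ⟨L, hL0, hL⟩ := hF.exists_norm_velocity_sub_le
  refine ⟨L, hL0, fun θ₁ hθ₁ θ₂ hθ₂ u v hu hv x y hx hy C K η hC hK hη t ht => ?_⟩
  set β : ℝ → ℝ := fun s => L * (1 + ‖v s‖)
  have hβ0 : ∀ s, 0 ≤ β s := fun s => by positivity
  have hβ : IntervalIntegrable β volume 0 T := (intervalIntegrable_const.add hv.norm).const_mul L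
  have hβK : ∀ t ∈ Set.Icc 0 T, ∫ s in (0 : ℝ)..t, β s ≤ L * K := fun t ht =>
    (intervalIntegral.integral_mono_interval le_rfl ht.1 ht.2 (ae_of_all _ hβ0) hβ).trans
      ((intervalIntegral.integral_const_mul _ _).trans_le (mul_le_mul_of_nonneg_left hK hL0))
  have hpar : ∀ t ∈ Set.Icc 0 T,
      ‖∫ s in (0 : ℝ)..t, (velocity F₀ F θ₂ (x s) (v s) - velocity F₀ F θ₁ (x s) (v s))‖
        ≤ 2 * C * ‖θ₂ - θ₁‖ * (L * K) := fun t ht => by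
    have h0 : (0 : ℝ) ∈ Set.Icc 0 T := Set.left_mem_Icc.2 (ht.1.trans ht.2)
    have hC0 : 0 ≤ C := (norm_nonneg _).trans (hC 0 h0)
    refine (norm_integral_velocity_sub_le hL0 (fun z w => by simpa using hL θ₂ hθ₂ θ₁ hθ₁ z z w)
      ht.1 (intervalIntegrable_of_mem_Icc hv h0 ht)
      fun s hs => hC s ⟨hs.1, hs.2.trans ht.2⟩).trans ?_
    gcongr
    exact hβK t ht
  have hres : ∀ t ∈ Set.Icc 0 T, ‖y t - x t - ∫ s in (0 : ℝ)..t,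
      (velocity F₀ F θ₂ (y s) (v s) - velocity F₀ F θ₂ (x s) (v s))‖
        ≤ ‖x₀ θ₂ - x₀ θ₁‖ + 2 * C * ‖θ₂ - θ₁‖ * (L * K) + η := fun t ht => by
    rw [hx.sub_sub_integral_eq hF hθ₁ hθ₂ hu hv hy ht]
    exact norm_add_le_of_le (norm_add_le_of_le le_rfl (hpar t ht)) (hη t ht)
  refine (norm_sub_le_mul_exp_integral (g := fun s z => velocity F₀ F θ₂ z (v s)) hβ0 hβ
    (fun s z w => by simpa using hL θ₂ hθ₂ θ₂ hθ₂ z w (v s)) hy.continuousOn hx.continuousOn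
    hres ht).trans ?_
  have := (norm_nonneg _).trans (hres t ht)
  gcongr
  exact hβK t ht

lemma LipschitzFields.eqOn_of_isTrajectory (hF : LipschitzFields Θ F₀ F) (hθ : θ ∈ Θ)
    {u : ℝ → Vec k} (hu : IntervalIntegrable u volume 0 T) {x y : ℝ → Vec d}
    (hx : IsTrajectory T F₀ F x₀ u θ x) (hy : IsTrajectory T F₀ F x₀ u θ y) :
    Set.EqOn x y (Set.Icc 0 T) := by
  intro t ht
  obtain ⟨L, -, hL⟩ := hF.exists_norm_trajectory_sub_le (T := T) (x₀ := x₀)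
  obtain ⟨C, hC⟩ := isCompact_Icc.exists_bound_of_continuousOn hy.continuousOn
  have := hL θ hθ θ hθ u u hu hu y x hy hx C _ 0 hC le_rfl (fun t _ => by simp) t ht
  simpa [sub_eq_zero] using this

end Trajectories

section Primitives

lemma one_div_toReal_le_one {p : ℝ≥0∞} (hp : 1 ≤ p) : 1 / p.toReal ≤ 1 := by
  rcases eq_or_ne p ∞ with rfl | hp'
  · simp
  · have : 1 ≤ p.toReal := (ENNReal.toReal_mono hp' hp)
    exact (one_div_le_one_div_of_le one_pos this).trans_eq one_div_one

lemma one_div_toReal_lt_one {p : ℝ≥0∞} (hp : 1 < p) : 1 / p.toReal < 1 := by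
  rcases eq_or_ne p ∞ with rfl | hp'
  · simp
  · have : 1 < p.toReal := (ENNReal.toReal_lt_toReal ENNReal.one_ne_top hp').2 hp
    exact (one_div_lt_one_div_of_lt one_pos this).trans_eq one_div_one

lemma setIntegral_norm_le_norm_mul_rpow {α V : Type*} {m : MeasurableSpace α} {μ : Measure α}
    [NormedAddCommGroup V] {p : ℝ≥0∞} [Fact (1 ≤ p)] (v : Lp V p μ) {s : Set α} (hs : μ s ≠ ∞) :
    ∫ r in s, ‖v r‖ ∂μ ≤ ‖v‖ * μ.real s ^ (1 - 1 / p.toReal) := by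
  have hp := sub_nonneg.2 (one_div_toReal_le_one (p := p) Fact.out)
  have hm := (Lp.aestronglyMeasurable v).mono_measure (μ.restrict_le_self (s := s))
  have hle : eLpNorm v 1 (μ.restrict s) ≤ eLpNorm v p μ * μ s ^ (1 - 1 / p.toReal) := by
    refine (eLpNorm_le_eLpNorm_mul_rpow_measure_univ (Fact.out : 1 ≤ p) hm).trans ?_
    simp only [Measure.restrict_apply_univ, ENNReal.toReal_one, div_one]
    gcongr
    exact Measure.restrict_le_self
  have := ENNReal.toReal_mono (ENNReal.mul_ne_top (Lp.eLpNorm_ne_top v)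
    (ENNReal.rpow_ne_top_of_nonneg hp hs)) hle
  rwa [ENNReal.toReal_mul, ← ENNReal.toReal_rpow, eLpNorm_one_eq_lintegral_enorm,
    ← integral_norm_eq_lintegral_enorm hm] at this

variable {V E : Type*} [NormedAddCommGroup V] [NormedAddCommGroup E] {T : ℝ} {p : ℝ≥0∞}
  [Fact (1 ≤ p)]

lemma intervalIntegrable_Lp (hT : 0 ≤ T) (v : Lp V p (timeMeasure T)) :
    IntervalIntegrable v volume 0 T :=
  (intervalIntegrable_iff_integrableOn_Icc_of_le hT).2 ((Lp.memLp v).integrable Fact.out)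

lemma integral_norm_le_norm_mul_rpow (v : Lp V p (timeMeasure T)) {s t : ℝ}
    (hs : s ∈ Set.Icc 0 T) (ht : t ∈ Set.Icc 0 T) (hst : s ≤ t) :
    ∫ r in s..t, ‖v r‖ ≤ ‖v‖ * (t - s) ^ (1 - 1 / p.toReal) := by
  have hsub : Set.Ioc s t ⊆ Set.Icc 0 T :=
    Set.Ioc_subset_Icc_self.trans (Set.Icc_subset_Icc hs.1 ht.2)
  have hreal : (timeMeasure T).real (Set.Ioc s t) = t - s := by
    rw [measureReal_restrict_apply measurableSet_Ioc, Set.inter_eq_left.2 hsub,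
      Real.volume_real_Ioc_of_le hst]
  have := setIntegral_norm_le_norm_mul_rpow v (measure_ne_top (timeMeasure T) (Set.Ioc s t))
  rwa [hreal, Measure.restrict_restrict measurableSet_Ioc, Set.inter_eq_left.2 hsub,
    ← intervalIntegral.integral_of_le hst] at this

lemma integral_one_add_norm_le (hT : 0 ≤ T) {ρ : ℝ} {v : Lp V p (timeMeasure T)} (hv : ‖v‖ ≤ ρ) :
    ∫ s in (0 : ℝ)..T, (1 + ‖v s‖) ≤ T + ρ * T ^ (1 - 1 / p.toReal) := by
  have h := integral_norm_le_norm_mul_rpow v (Set.left_mem_Icc.2 hT) (Set.right_mem_Icc.2 hT) hT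
  rw [sub_zero] at h
  rw [intervalIntegral.integral_add intervalIntegrable_const (intervalIntegrable_Lp hT v).norm,
    intervalIntegral.integral_const, smul_eq_mul, mul_one, sub_zero]
  gcongr
  exact h.trans (by gcongr)

variable [NormedSpace ℝ V] [NormedSpace ℝ E] {A : ℝ → V →L[ℝ] E}

lemma intervalIntegrable_clm_apply_Lp (hA : ContinuousOn A (Set.Icc 0 T))
    (v : Lp V p (timeMeasure T)) {s t : ℝ} (hs : s ∈ Set.Icc 0 T) (ht : t ∈ Set.Icc 0 T) :
    IntervalIntegrable (fun r => A r (v r)) volume s t :=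
  have hT := hs.1.trans hs.2
  intervalIntegrable_of_mem_Icc (intervalIntegrable_clm_apply
    (by rwa [Set.uIcc_of_le hT]) (intervalIntegrable_Lp hT v)) hs ht

lemma norm_integral_clm_apply_le {C : ℝ} (hC : ∀ s ∈ Set.Icc 0 T, ‖A s‖ ≤ C)
    (v : Lp V p (timeMeasure T)) {s t : ℝ} (hs : s ∈ Set.Icc 0 T) (ht : t ∈ Set.Icc 0 T) :
    ‖∫ r in s..t, A r (v r)‖ ≤ C * (‖v‖ * |t - s| ^ (1 - 1 / p.toReal)) := by
  wlog hst : s ≤ t generalizing s t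
  · rw [intervalIntegral.integral_symm, norm_neg, abs_sub_comm]
    exact this ht hs (le_of_not_ge hst)
  have hT := hs.1.trans hs.2
  calc ‖∫ r in s..t, A r (v r)‖ ≤ ∫ r in s..t, C * ‖v r‖ :=
        intervalIntegral.norm_integral_le_of_norm_le hst
          (ae_of_all _ fun r hr => (A r).le_of_opNorm_le (hC r
            ⟨hs.1.trans hr.1.le, hr.2.trans ht.2⟩) _)
          ((intervalIntegrable_of_mem_Icc (intervalIntegrable_Lp hT v) hs ht).norm.const_mul C)
    _ = C * ∫ r in s..t, ‖v r‖ := intervalIntegral.integral_const_mul _ _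
    _ ≤ C * (‖v‖ * |t - s| ^ (1 - 1 / p.toReal)) := by
        rw [abs_of_nonneg (sub_nonneg.2 hst)]
        exact mul_le_mul_of_nonneg_left (integral_norm_le_norm_mul_rpow v hs ht hst)
          ((norm_nonneg _).trans (hC s hs))

lemma isBoundedLinearMap_integral_clm_apply (hA : ContinuousOn A (Set.Icc 0 T)) {t : ℝ}
    (ht : t ∈ Set.Icc 0 T) : IsBoundedLinearMap ℝ
      fun v : Lp V p (timeMeasure T) => ∫ s in (0 : ℝ)..t, A s (v s) := by
  obtain ⟨C, hC⟩ := isCompact_Icc.exists_bound_of_continuousOn hA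
  have h0 : (0 : ℝ) ∈ Set.Icc 0 T := Set.left_mem_Icc.2 (ht.1.trans ht.2)
  have hae : ∀ {P : ℝ → Prop}, (∀ᵐ s ∂timeMeasure T, P s) → ∀ᵐ s, s ∈ Set.uIoc 0 t → P s := by
    intro P hP
    filter_upwards [(ae_restrict_iff' measurableSet_Icc).1 hP] with s hs hst
    rw [Set.uIoc_of_le ht.1] at hst
    exact hs ⟨hst.1.le, hst.2.trans ht.2⟩
  refine IsLinearMap.with_bound ⟨fun v w => ?_, fun c v => ?_⟩
    (C * |t - 0| ^ (1 - 1 / p.toReal)) fun v => ?_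
  · rw [← intervalIntegral.integral_add (intervalIntegrable_clm_apply_Lp hA v h0 ht)
      (intervalIntegrable_clm_apply_Lp hA w h0 ht)]
    refine intervalIntegral.integral_congr_ae ((hae (Lp.coeFn_add v w)).mono fun s hs hst => ?_)
    simp only [hs hst, Pi.add_apply, map_add]
  · rw [← intervalIntegral.integral_smul]
    refine intervalIntegral.integral_congr_ae ((hae (Lp.coeFn_smul c v)).mono fun s hs hst => ?_)
    simp only [hs hst, Pi.smul_apply, map_smul]
  · exact (norm_integral_clm_apply_le hC v h0 ht).trans_eq (by ring)

lemma continuous_clm_weakSpace {X : Type*} [NormedAddCommGroup X] [NormedSpace ℝ X]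
    [FiniteDimensional ℝ E] (Λ : X →L[ℝ] E) :
    Continuous fun v : WeakSpace ℝ X => Λ ((toWeakSpace ℝ X).symm v) := by
  have : FiniteDimensional ℝ (WeakSpace ℝ E) := ‹FiniteDimensional ℝ E›
  exact (toWeakSpace ℝ E).symm.toLinearMap.continuous_of_finiteDimensional.comp
    (WeakSpace.map Λ).continuous

theorem tendstoUniformlyOn_integral_clm_apply [FiniteDimensional ℝ E] (hp : 1 < p)
    (hA : ContinuousOn A (Set.Icc 0 T)) {ι : Type*} {l : Filter ι} {ρ : ℝ}
    {v : ι → Lp V p (timeMeasure T)} {u : Lp V p (timeMeasure T)} (hv : ∀ i, ‖v i‖ ≤ ρ)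
    (hlim : Tendsto (fun i => toWeakSpace ℝ _ (v i)) l (𝓝 (toWeakSpace ℝ _ u))) :
    TendstoUniformlyOn (fun i t => ∫ s in (0 : ℝ)..t, A s (v i s))
      (fun t => ∫ s in (0 : ℝ)..t, A s (u s)) l (Set.Icc 0 T) := by
  obtain ⟨C, hC⟩ := isCompact_Icc.exists_bound_of_continuousOn hA
  set α := 1 - 1 / p.toReal
  have hα : 0 < α := sub_pos.2 (one_div_toReal_lt_one hp)
  have hmod : Tendsto (fun r : ℝ => C * (ρ * r ^ α)) (𝓝 0) (𝓝 0) := by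
    have := (((Real.continuousAt_rpow_const 0 α (Or.inr hα.le)).tendsto.const_mul ρ).const_mul C)
    simpa [Real.zero_rpow hα.ne'] using this
  have hequi : Equicontinuous fun i (t : Set.Icc 0 T) => ∫ s in (0 : ℝ)..t, A s (v i s) := by
    refine Metric.equicontinuous_of_continuity_modulus _ hmod _ fun t r i => ?_
    have h0 : (0 : ℝ) ∈ Set.Icc 0 T := Set.left_mem_Icc.2 (t.2.1.trans t.2.2)
    have hC0 := (norm_nonneg _).trans (hC 0 h0)
    rw [dist_eq_norm, intervalIntegral.integral_interval_sub_left
      (intervalIntegrable_clm_apply_Lp hA _ h0 t.2) (intervalIntegrable_clm_apply_Lp hA _ h0 r.2)]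
    refine (norm_integral_clm_apply_le hC (v i) r.2 t.2).trans ?_
    rw [Subtype.dist_eq, Real.dist_eq]
    gcongr
    exact hv i
  rw [tendstoUniformlyOn_iff_tendstoUniformly_comp_coe]
  refine UniformFun.tendsto_iff_tendstoUniformly.1 ((hequi.tendsto_uniformFun_iff_pi l _).2
    (tendsto_pi_nhds.2 fun t => ?_))
  exact ((continuous_clm_weakSpace (isBoundedLinearMap_integral_clm_apply
    hA t.2).toContinuousLinearMap).tendsto _).comp hlim

end Primitives

section Endpoint

variable {d k l : ℕ} {T : ℝ} {p : ℝ≥0∞} [Fact (1 ≤ p)] {Θ : Set (Vec l)}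
  {F₀ : Vec d → Vec l → Vec d} {F : Vec d → Vec l → Fin k → Vec d} {x₀ : Vec l → Vec d}
  {a : Vec d → Vec l → ℝ}

theorem LipschitzFields.tendstoUniformlyOn_trajectory (hF : LipschitzFields Θ F₀ F) (hT : 0 ≤ T)
    (hx₀ : ContinuousOn x₀ Θ) (hp : 1 < p) {ι : Type*} {𝓕 : Filter ι} {ρ : ℝ}
    {v : ι → Control T k p} {u : Control T k p} (hv : ∀ i, ‖v i‖ ≤ ρ)
    (hvu : Tendsto (fun i => toWeakSpace ℝ _ (v i)) 𝓕 (𝓝 (toWeakSpace ℝ _ u)))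
    {η : ι → Vec l} {θ : Vec l} (hη : ∀ i, η i ∈ Θ) (hθ : θ ∈ Θ) (hηθ : Tendsto η 𝓕 (𝓝 θ)) :
    TendstoUniformlyOn (fun i => trajectory T F₀ F x₀ (v i) (η i)) (trajectory T F₀ F x₀ u θ) 𝓕
      (Set.Icc 0 T) := by
  have htraj : ∀ (w : Control T k p) {θ'}, θ' ∈ Θ →
      IsTrajectory T F₀ F x₀ w θ' (trajectory T F₀ F x₀ w θ') :=
    fun w _ hθ' => hF.isTrajectory_trajectory hT hθ' (intervalIntegrable_Lp hT w) x₀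
  have hx := (htraj u hθ).continuousOn
  obtain ⟨L, -, hL⟩ := hF.exists_norm_trajectory_sub_le (T := T) (x₀ := x₀)
  obtain ⟨C, hC⟩ := isCompact_Icc.exists_bound_of_continuousOn hx
  have hprim := tendstoUniformlyOn_integral_clm_apply hp
    ((hF.continuous_controlMap hθ).comp_continuousOn hx) hv hvu
  set K := T + ρ * T ^ (1 - 1 / p.toReal)
  rw [Metric.tendstoUniformlyOn_iff]
  intro ε hε
  obtain ⟨δ, hδ, hδε⟩ : ∃ δ > 0, δ * Real.exp (L * K) < ε :=
    ⟨ε / (2 * Real.exp (L * K)), by positivity, by field_simp; norm_num⟩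
  have hbound : Tendsto (fun i => (‖x₀ (η i) - x₀ θ‖ + 2 * C * ‖η i - θ‖ * (L * K) + δ)
      * Real.exp (L * K)) 𝓕 (𝓝 ((0 + 2 * C * 0 * (L * K) + δ) * Real.exp (L * K))) := by
    have hx₀η : Tendsto (fun i => x₀ (η i)) 𝓕 (𝓝 (x₀ θ)) :=
      (hx₀ θ hθ).tendsto.comp (tendsto_nhdsWithin_iff.2 ⟨hηθ, .of_forall hη⟩)
    have hη0 := tendsto_iff_norm_sub_tendsto_zero.1 hηθ
    exact (((tendsto_iff_norm_sub_tendsto_zero.1 hx₀η).add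
      ((hη0.const_mul _).mul_const _)).add_const _).mul_const _
  rw [mul_zero, zero_mul, zero_add, zero_add] at hbound
  filter_upwards [Metric.tendstoUniformlyOn_iff.1 hprim δ hδ, hbound.eventually (gt_mem_nhds hδε)]
    with i hi hiε t ht
  rw [dist_comm, dist_eq_norm]
  refine (hL θ hθ (η i) (hη i) u (v i) (intervalIntegrable_Lp hT u) (intervalIntegrable_Lp hT _)
    _ _ (htraj u hθ) (htraj (v i) (hη i)) C K δ hC (integral_one_add_norm_le hT (hv i))
    (fun s hs => ?_) t ht).trans_lt hiε
  rw [← dist_eq_norm, dist_comm]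
  exact (hi s hs).le

/-- The terminal cost `a(x_u^θ(T), θ)` of a single parameter. -/
noncomputable def endpointCost (T : ℝ) (F₀ : Vec d → Vec l → Vec d)
    (F : Vec d → Vec l → Fin k → Vec d) (x₀ : Vec l → Vec d) (a : Vec d → Vec l → ℝ)
    (θ : Vec l) (u : ℝ → Vec k) : ℝ :=
  a (trajectory T F₀ F x₀ u θ T) θ

theorem LipschitzFields.continuous_endpointCost (hF : LipschitzFields Θ F₀ F) (hT : 0 ≤ T)
    (hx₀ : ContinuousOn x₀ Θ) (ha : TerminalCost Θ a) (hp : 1 < p) (ρ : ℝ) :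
    Continuous fun z : Θ × weakBall T k p ρ =>
      endpointCost T F₀ F x₀ a z.1 ((toWeakSpace ℝ (Control T k p)).symm z.2) := by
  have hendpoint : Continuous fun z : Θ × weakBall T k p ρ =>
      trajectory T F₀ F x₀ ((toWeakSpace ℝ (Control T k p)).symm z.2) z.1 T :=
    continuous_iff_continuousAt.2 fun z =>
      (hF.tendstoUniformlyOn_trajectory hT hx₀ hp (𝓕 := 𝓝 z) (fun z' => z'.2.2)
        (continuous_subtype_val.comp continuous_snd).continuousAt
        (fun z' => z'.1.2) z.1.2
        (continuous_subtype_val.comp continuous_fst).continuousAt).tendsto_at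
        (Set.right_mem_Icc.2 hT)
  exact ha.continuousOn.comp_continuous
    (hendpoint.prodMk (continuous_subtype_val.comp continuous_fst))
    fun z => ⟨Set.mem_univ _, z.1.2⟩

lemma LipschitzFields.continuousOn_endpointCost (hF : LipschitzFields Θ F₀ F) (hT : 0 ≤ T)
    (hx₀ : ContinuousOn x₀ Θ) (ha : TerminalCost Θ a) (hp : 1 < p) (u : Control T k p) :
    ContinuousOn (fun θ => endpointCost T F₀ F x₀ a θ u) Θ := by
  let u' : weakBall T k p ‖u‖ := ⟨toWeakSpace ℝ _ u, le_refl ‖u‖⟩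
  exact continuousOn_iff_continuous_domRestrict.2
    ((hF.continuous_endpointCost hT hx₀ ha hp ‖u‖).comp (Continuous.prodMk_left u'))

lemma exists_dist_lt_of_continuous {X Y M : Type*} [PseudoMetricSpace X] [CompactSpace X]
    [TopologicalSpace Y] [CompactSpace Y] [PseudoMetricSpace M] {φ : X × Y → M}
    (hφ : Continuous φ) {ε : ℝ} (hε : 0 < ε) :
    ∃ δ > 0, ∀ x x' : X, dist x x' < δ → ∀ y, dist (φ (x, y)) (φ (x', y)) < ε := by
  obtain ⟨δ, hδ, h⟩ := Metric.uniformContinuous_iff.1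
    (CompactSpace.uniformContinuous_of_continuous (ContinuousMap.curry ⟨φ, hφ⟩).continuous) ε hε
  exact ⟨δ, hδ, fun x x' hx y => (ContinuousMap.dist_apply_le_dist y).trans_lt (h hx)⟩

end Endpoint

section WeakCompactness

variable {E : Type*} [NormedAddCommGroup E] [NormedSpace ℝ E]

/-- `𝓖` consists of almost-shortest vectors of the closed convex hulls of the members of `𝓕`. -/
lemma exists_le_lift'_closedConvexHull_tendsto_norm {𝓕 : Filter E} [NeBot 𝓕] {ρ : ℝ}
    (hρ : Metric.closedBall 0 ρ ∈ 𝓕) :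
    ∃ (𝓖 : Filter E) (r : ℝ), NeBot 𝓖 ∧ 𝓖 ≤ 𝓕.lift' (closedConvexHull ℝ) ∧
      Tendsto norm 𝓖 (𝓝 r) ∧
      ∀ ε > 0, ∃ S ∈ 𝓕, ∀ x ∈ closedConvexHull ℝ S, r - ε ≤ ‖x‖ := by
  let m : Set E → ℝ := fun S => Metric.infDist 0 (closedConvexHull ℝ S)
  have hm_le : ∀ {S : Set E} {x}, x ∈ closedConvexHull ℝ S → m S ≤ ‖x‖ := fun {S x} hx => by
    simpa using Metric.infDist_le_dist_of_mem (x := 0) hx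
  have hm_anti : ∀ {S S' : Set E}, S.Nonempty → S ⊆ S' → m S' ≤ m S := fun hS h =>
    Metric.infDist_le_infDist_of_subset ((closedConvexHull ℝ).monotone h)
      (hS.mono subset_closedConvexHull)
  have hbdd : BddAbove (Set.range fun S : {S // S ∈ 𝓕} => m S) := by
    refine ⟨ρ, ?_⟩
    rintro _ ⟨⟨S, hS⟩, rfl⟩
    obtain ⟨x, hxS, hxρ⟩ := nonempty_of_mem (inter_mem hS hρ)
    exact (hm_le (subset_closedConvexHull hxS)).trans (mem_closedBall_zero_iff.1 hxρ)
  have : Nonempty {S // S ∈ 𝓕} := ⟨⟨_, hρ⟩⟩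
  set r := ⨆ S : {S // S ∈ 𝓕}, m S
  have hm_r : ∀ S ∈ 𝓕, m S ≤ r := fun S hS => le_ciSup hbdd ⟨S, hS⟩
  have hr_m : ∀ ε > 0, ∃ S ∈ 𝓕, r - ε < m S := fun ε hε =>
    let ⟨⟨S, hS⟩, h⟩ := exists_lt_of_lt_ciSup (sub_lt_self r hε); ⟨S, hS, h⟩
  refine ⟨𝓕.lift' (closedConvexHull ℝ) ⊓ comap norm (𝓝 r), r, ?_, inf_le_left,
    tendsto_comap.mono_left inf_le_right, fun ε hε => ?_⟩
  · refine ((𝓕.basis_sets.lift' (closedConvexHull ℝ).monotone).inf_basis_neBot_iff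
      ((nhds_basis_abs_sub_lt r).comap norm)).2 fun S hS ε hε => ?_
    obtain ⟨S', hS', hlt⟩ := hr_m ε hε
    have hSS' := nonempty_of_mem (inter_mem hS hS')
    have hlt' := hlt.trans_le (hm_anti hSS' Set.inter_subset_right)
    obtain ⟨x, hx, hxr⟩ := (Metric.infDist_lt_iff (hSS'.mono subset_closedConvexHull)).1
      ((hm_r _ (inter_mem hS hS')).trans_lt (lt_add_of_pos_right r hε))
    rw [dist_zero_left] at hxr
    refine ⟨x, (closedConvexHull ℝ).monotone Set.inter_subset_left hx, ?_⟩
    have hmx := hm_le hx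
    have habs : |‖x‖ - r| < ε := abs_sub_lt_iff.2 ⟨by linarith, by linarith⟩
    exact habs
  · obtain ⟨S, hS, hlt⟩ := hr_m ε hε
    exact ⟨S, hS, fun x hx => hlt.le.trans (hm_le hx)⟩

variable [UniformConvexSpace E]

lemma exists_norm_add_le_two_mul_sub_of_le {ε : ℝ} (hε : 0 < ε) (R : ℝ) :
    ∃ δ > 0, ∀ r ≤ R, ∀ x y : E, ‖x‖ ≤ r → ‖y‖ ≤ r → ε ≤ ‖x - y‖ → ‖x + y‖ ≤ 2 * r - δ := by
  obtain ⟨δ, hδ, h⟩ := exists_forall_closed_ball_dist_add_le_two_sub E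
    (show 0 < ε / (|R| + 1) by positivity)
  refine ⟨ε / 2 * δ, by positivity, fun r hr x y hx hy hxy => ?_⟩
  have hεr : ε / 2 ≤ r := by linarith [hxy.trans (norm_sub_le x y)]
  have hr0 : 0 < r := (half_pos hε).trans_le hεr
  have hscale : ∀ z : E, ‖r⁻¹ • z‖ = ‖z‖ / r := fun z => by
    rw [norm_smul, norm_inv, Real.norm_of_nonneg hr0.le, inv_mul_eq_div]
  have hunit := h (x := r⁻¹ • x) (by rwa [hscale, div_le_one hr0]) (y := r⁻¹ • y)
    (by rwa [hscale, div_le_one hr0]) (by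
      rw [← smul_sub, hscale]
      have := hr.trans (le_abs_self R)
      exact div_le_div₀ (norm_nonneg _) hxy hr0 (by linarith))
  rw [← smul_add, hscale, div_le_iff₀ hr0] at hunit
  nlinarith

lemma cauchy_of_tendsto_norm_of_convex {𝓖 : Filter E} [NeBot 𝓖] {r : ℝ}
    (hnorm : Tendsto norm 𝓖 (𝓝 r))
    (hconv : ∀ ε > 0, ∃ C ∈ 𝓖, Convex ℝ C ∧ ∀ x ∈ C, r - ε ≤ ‖x‖) : Cauchy 𝓖 := by
  refine Metric.cauchy_iff.2 ⟨‹_›, fun ε hε => ?_⟩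
  obtain ⟨δ, hδ, hgap⟩ := exists_norm_add_le_two_mul_sub_of_le (E := E) hε (r + 1)
  obtain ⟨κ, hκ, hκ1, hκδ⟩ : ∃ κ > 0, κ ≤ 1 ∧ 4 * κ < δ :=
    ⟨min 1 (δ / 8), by positivity, min_le_left _ _, by linarith [min_le_right 1 (δ / 8)]⟩
  obtain ⟨C, hC, hCconv, hCnorm⟩ := hconv κ hκ
  refine ⟨_, inter_mem hC (hnorm (Iio_mem_nhds (lt_add_of_pos_right r hκ))),
    fun x hx y hy => ?_⟩
  by_contra! hxy
  rw [dist_eq_norm] at hxy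
  have hsum := hgap (r + κ) (by linarith) x y (le_of_lt hx.2) (le_of_lt hy.2) hxy
  have hmid := hCnorm _ (hCconv.midpoint_mem hx.1 hy.1)
  rw [midpoint_eq_smul_add, norm_smul, invOf_eq_inv, norm_inv, Real.norm_two] at hmid
  linarith

theorem exists_mem_of_isClosed_of_convex [CompleteSpace E] {𝓕 : Filter E} [NeBot 𝓕] {ρ : ℝ}
    (hρ : Metric.closedBall 0 ρ ∈ 𝓕) : ∃ x, ∀ C ∈ 𝓕, IsClosed C → Convex ℝ C → x ∈ C := by
  obtain ⟨𝓖, r, _, h𝓖, hnorm, hr⟩ := exists_le_lift'_closedConvexHull_tendsto_norm hρ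
  have hcauchy : Cauchy 𝓖 := cauchy_of_tendsto_norm_of_convex hnorm fun ε hε =>
    let ⟨S, hS, hSr⟩ := hr ε hε
    ⟨_, h𝓖 (mem_lift' hS), convex_closedConvexHull, hSr⟩
  obtain ⟨x, hx⟩ := CompleteSpace.complete hcauchy
  refine ⟨x, fun C hC hclosed hconv => hclosed.mem_of_tendsto (tendsto_id'.2 hx)
    (mem_of_superset (h𝓖 (mem_lift' hC)) ?_)⟩
  exact closedConvexHull_min subset_rfl hconv hclosed

/-- The Milman–Pettis theorem, stated as weak compactness of balls. -/
theorem isCompact_weakSpace_closedBall [CompleteSpace E] (ρ : ℝ) :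
    IsCompact {u : WeakSpace ℝ E | ‖(toWeakSpace ℝ E).symm u‖ ≤ ρ} := by
  rw [isCompact_iff_ultrafilter_le_nhds']
  intro 𝒰 h𝒰
  let 𝒱 : Ultrafilter E := 𝒰.map (toWeakSpace ℝ E).symm
  have hball : Metric.closedBall (0 : E) ρ ∈ 𝒱 :=
    mem_of_superset h𝒰 fun u hu => mem_closedBall_zero_iff.2 hu
  obtain ⟨x, hx⟩ := exists_mem_of_isClosed_of_convex hball
  refine ⟨toWeakSpace ℝ E x, ?_, ?_⟩
  · exact mem_closedBall_zero_iff.1 (hx _ hball Metric.isClosed_closedBall (convex_closedBall _ _))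
  have hlim : ∀ ℓ : StrongDual ℝ E, Tendsto ℓ 𝒱 (𝓝 (ℓ x)) := by
    refine fun ℓ => tendsto_order.2 ⟨fun b hb => ?_, fun b hb => ?_⟩ <;> by_contra hev <;>
      rw [← Ultrafilter.eventually_not] at hev <;> simp only [not_lt] at hev
    · exact hb.not_ge (hx _ hev (isClosed_le ℓ.continuous continuous_const)
        (convex_halfSpace_le ℓ.isLinear b))
    · exact hb.not_ge (hx _ hev (isClosed_le continuous_const ℓ.continuous)
        (convex_halfSpace_ge ℓ.isLinear b))
  have hind : IsInducing fun (u : WeakSpace ℝ E) (ℓ : StrongDual ℝ E) =>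
    ℓ ((toWeakSpace ℝ E).symm u) := ⟨rfl⟩
  rw [hind.nhds_eq_comap, ← map_le_iff_le_comap]
  exact tendsto_pi_nhds.2 hlim

end WeakCompactness

section UniformConvexity

variable {V : Type*} [NormedAddCommGroup V] {q : ℝ}

lemma norm_add_half_rpow_le (hq : 1 ≤ q) (a b : V) :
    (‖a + b‖ / 2) ^ q ≤ (‖a‖ ^ q + ‖b‖ ^ q) / 2 := by
  have hconv := (convexOn_rpow hq).2 (norm_nonneg a) (norm_nonneg b)
    (show (0 : ℝ) ≤ 1 / 2 by norm_num) (show (0 : ℝ) ≤ 1 / 2 by norm_num) (by norm_num)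
  simp only [smul_eq_mul] at hconv
  calc (‖a + b‖ / 2) ^ q ≤ (1 / 2 * ‖a‖ + 1 / 2 * ‖b‖) ^ q := by
        gcongr
        linarith [norm_add_le a b]
    _ ≤ (‖a‖ ^ q + ‖b‖ ^ q) / 2 := hconv.trans_eq (by ring)

variable {α : Type*} [MeasurableSpace α] {μ : Measure α} {p : ℝ≥0∞} [Fact (1 ≤ p)]

lemma norm_rpow_eq_integral (hp : p ≠ ∞) (u : Lp V p μ) :
    ‖u‖ ^ p.toReal = ∫ t, ‖u t‖ ^ p.toReal ∂μ := by
  have hp0 : p ≠ 0 := (one_pos.trans_le (Fact.out : 1 ≤ p)).ne'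
  have hint : 0 ≤ ∫ t, ‖u t‖ ^ p.toReal ∂μ := integral_nonneg fun t => by positivity
  rw [Lp.norm_def, (Lp.memLp u).eLpNorm_eq_integral_rpow_norm hp0 hp,
    ENNReal.toReal_ofReal (by positivity),
    Real.rpow_inv_rpow hint (ENNReal.toReal_pos hp0 hp).ne']

variable [NormedSpace ℝ V] [UniformConvexSpace V]

lemma exists_le_rpow_gap (hq : 1 < q) {ε : ℝ} (hε : 0 < ε) :
    ∃ δ > 0, ∀ a b : V, ‖a‖ = 1 → ‖b‖ ≤ 1 → ε ≤ ‖a - b‖ →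
      δ ≤ (‖a‖ ^ q + ‖b‖ ^ q) / 2 - (‖a + b‖ / 2) ^ q := by
  have hq0 : 0 < q := one_pos.trans hq
  obtain ⟨κ, hκ, hκV⟩ := exists_forall_closed_ball_dist_add_le_two_sub V hε
  let w : ℝ → ℝ := fun s => max 0 (min (1 - κ / 2) ((1 + s) / 2))
  let G : ℝ → ℝ := fun s => (1 + s ^ q) / 2 - w s ^ q
  have hG : ContinuousOn G (Set.Icc 0 1) :=
    ((continuousOn_const.add (continuousOn_id.rpow_const fun _ _ => Or.inr hq0.le)).div_const
      2).sub (ContinuousOn.rpow_const (by fun_prop) fun _ _ => Or.inr hq0.le)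
  have hGpos : ∀ s ∈ Set.Icc (0 : ℝ) 1, 0 < G s := by
    intro s hs
    refine sub_pos.2 ?_
    rcases hs.2.eq_or_lt with rfl | hs1
    · rw [Real.one_rpow, add_self_div_two]
      exact Real.rpow_lt_one (le_max_left _ _)
        (max_lt one_pos ((min_le_left _ _).trans_lt (by linarith))) hq0
    · have hstrict := (strictConvexOn_rpow hq).2 (Set.mem_Ici.2 zero_le_one) hs.1 hs1.ne'
        (show (0 : ℝ) < 1 / 2 by norm_num) (show (0 : ℝ) < 1 / 2 by norm_num) (by norm_num)
      simp only [smul_eq_mul, Real.one_rpow] at hstrict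
      calc w s ^ q ≤ (1 / 2 * 1 + 1 / 2 * s) ^ q :=
            Real.rpow_le_rpow (le_max_left _ _) (max_le (by linarith [hs.1])
              ((min_le_right _ _).trans_eq (by ring))) hq0.le
        _ < (1 + s ^ q) / 2 := hstrict.trans_eq (by ring)
  obtain ⟨s₀, hs₀, hmin⟩ := isCompact_Icc.exists_isMinOn (Set.nonempty_Icc.2 zero_le_one) hG
  refine ⟨G s₀, hGpos s₀ hs₀, fun a b ha hb hab => ?_⟩
  refine (hmin (a := ‖b‖) ⟨norm_nonneg b, hb⟩).trans ?_
  have hsum := hκV ha.le hb hab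
  have htri := norm_add_le a b
  simp only [G, w, ha, Real.one_rpow] at htri ⊢
  gcongr
  exact le_max_of_le_right (le_min (by linarith) (by linarith))

lemma exists_norm_sub_rpow_le_of_norm_eq_one (hq : 1 < q) {η : ℝ} (hη : 0 < η) :
    ∃ K > 0, ∀ a b : V, ‖a‖ = 1 → ‖b‖ ≤ 1 → ‖a - b‖ ^ q ≤ η * (‖a‖ ^ q + ‖b‖ ^ q)
      + K * ((‖a‖ ^ q + ‖b‖ ^ q) / 2 - (‖a + b‖ / 2) ^ q) := by
  have hq0 : 0 < q := one_pos.trans hq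
  obtain ⟨δ, hδ, hgap⟩ := exists_le_rpow_gap (V := V) hq (Real.rpow_pos_of_pos hη q⁻¹)
  refine ⟨2 ^ q / δ, by positivity, fun a b ha hb => ?_⟩
  rcases le_total (‖a - b‖) (η ^ q⁻¹) with hab | hab
  · calc ‖a - b‖ ^ q ≤ (η ^ q⁻¹) ^ q := by gcongr
      _ = η * (‖a‖ ^ q + 0) + 2 ^ q / δ * 0 := by
        rw [Real.rpow_inv_rpow hη.le hq0.ne', ha, Real.one_rpow]; ring
      _ ≤ _ := by
        have := sub_nonneg.2 (norm_add_half_rpow_le hq.le a b)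
        gcongr
        positivity
  · calc ‖a - b‖ ^ q ≤ 2 ^ q := by
          gcongr
          linarith [norm_sub_le a b]
      _ = 0 + 2 ^ q / δ * δ := by field_simp; simp
      _ ≤ _ := by
        gcongr
        · positivity
        · exact hgap a b ha hb hab

/-- Being linear in the `q`-th powers, this integrates to the same inequality in `L^q`. -/
lemma exists_norm_sub_rpow_le (hq : 1 < q) {η : ℝ} (hη : 0 < η) :
    ∃ K > 0, ∀ a b : V, ‖a - b‖ ^ q ≤ η * (‖a‖ ^ q + ‖b‖ ^ q)
      + K * ((‖a‖ ^ q + ‖b‖ ^ q) / 2 - (‖a + b‖ / 2) ^ q) := by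
  obtain ⟨K, hK, hunit⟩ := exists_norm_sub_rpow_le_of_norm_eq_one (V := V) hq hη
  refine ⟨K, hK, fun a b => ?_⟩
  wlog hba : ‖b‖ ≤ ‖a‖ generalizing a b
  · simpa only [norm_sub_rev, add_comm] using this b a (le_of_not_ge hba)
  rcases (norm_nonneg a).eq_or_lt with ha | ha
  · obtain rfl := norm_eq_zero.1 ha.symm
    obtain rfl := norm_le_zero_iff.1 (hba.trans_eq ha.symm)
    simp [Real.zero_rpow (one_pos.trans hq).ne']
  obtain ⟨r, hr⟩ : ∃ r, r = ‖a‖ := ⟨_, rfl⟩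
  rw [← hr] at ha hba
  have hnorm : ∀ v : V, ‖r⁻¹ • v‖ = r⁻¹ * ‖v‖ := fun v => by
    rw [norm_smul, norm_inv, Real.norm_of_nonneg ha.le]
  have hscale : ∀ v : V, ‖v‖ ^ q = r ^ q * ‖r⁻¹ • v‖ ^ q := fun v => by
    rw [← Real.mul_rpow ha.le (norm_nonneg _), hnorm, mul_inv_cancel_left₀ ha.ne']
  have hnormalized := hunit (r⁻¹ • a) (r⁻¹ • b)
    (by rw [hnorm, ← hr, inv_mul_cancel₀ ha.ne'])
    (by rwa [hnorm, inv_mul_le_one₀ ha])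
  simp only [← smul_sub, ← smul_add, Real.div_rpow (norm_nonneg _) zero_le_two] at hnormalized ⊢
  rw [hscale (a - b), hscale (a + b), hscale b, hscale a]
  exact (mul_le_mul_of_nonneg_left hnormalized (by positivity)).trans_eq (by ring)

lemma exists_norm_sub_rpow_le_Lp (hp1 : 1 < p) (hp : p ≠ ∞) {η : ℝ} (hη : 0 < η) :
    ∃ K > 0, ∀ u v : Lp V p μ, ‖u - v‖ ^ p.toReal ≤ η * (‖u‖ ^ p.toReal + ‖v‖ ^ p.toReal)
      + K * ((‖u‖ ^ p.toReal + ‖v‖ ^ p.toReal) / 2 - (‖u + v‖ / 2) ^ p.toReal) := by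
  have hq : 1 < p.toReal := (ENNReal.toReal_lt_toReal ENNReal.one_ne_top hp).2 hp1
  obtain ⟨K, hK0, hK⟩ := exists_norm_sub_rpow_le (V := V) hq hη
  refine ⟨K, hK0, fun u v => ?_⟩
  have hint : ∀ w : Lp V p μ, Integrable (fun t => ‖w t‖ ^ p.toReal) μ := fun w =>
    (Lp.memLp w).integrable_norm_rpow (one_pos.trans hp1).ne' hp
  have hsum : Integrable (fun t => ‖u t‖ ^ p.toReal + ‖v t‖ ^ p.toReal) μ :=
    (hint u).add (hint v)
  have hgap : Integrable (fun t => K * ((‖u t‖ ^ p.toReal + ‖v t‖ ^ p.toReal) / 2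
      - ‖(u + v) t‖ ^ p.toReal / 2 ^ p.toReal)) μ :=
    ((hsum.div_const 2).sub ((hint (u + v)).div_const _)).const_mul K
  simp only [Real.div_rpow (norm_nonneg _) zero_le_two, norm_rpow_eq_integral hp] at hK ⊢
  rw [← integral_add (hint u) (hint v), ← integral_const_mul, ← integral_div, ← integral_div,
    ← integral_sub (hsum.div_const 2) ((hint (u + v)).div_const _), ← integral_const_mul,
    ← integral_add (hsum.const_mul η) hgap]
  refine integral_mono_ae (hint (u - v)) ((hsum.const_mul η).add hgap) ?_
  filter_upwards [Lp.coeFn_sub u v, Lp.coeFn_add u v] with t hsub hadd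
  simpa only [hsub, hadd, Pi.sub_apply, Pi.add_apply] using hK (u t) (v t)

theorem uniformConvexSpace_Lp (hp1 : 1 < p) (hp : p ≠ ∞) : UniformConvexSpace (Lp V p μ) where
  uniform_convex ε hε := by
    set q := p.toReal with hqdef
    have hq : 1 < q := (ENNReal.toReal_lt_toReal ENNReal.one_ne_top hp).2 hp1
    obtain ⟨K, hK0, hK⟩ := exists_norm_sub_rpow_le_Lp (V := V) (μ := μ) hp1 hp
      (show 0 < ε ^ q / 4 by positivity)
    refine ⟨ε ^ q / (K * q), by positivity, fun u hu v hv huv => ?_⟩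
    have hgap := hK u v
    simp only [hu, hv, Real.one_rpow, ← hqdef] at hgap
    have hεq : ε ^ q ≤ ‖u - v‖ ^ q := by gcongr
    have hbernoulli := one_add_mul_self_le_rpow_one_add (s := ‖u + v‖ / 2 - 1)
      (by linarith [norm_nonneg (u + v)]) hq.le
    rw [add_sub_cancel] at hbernoulli
    rw [le_sub_iff_add_le, ← le_sub_iff_add_le', div_le_iff₀ (by positivity)]
    nlinarith

theorem isCompact_weakBall {T : ℝ} {k : ℕ} (hp1 : 1 < p) (hp : p ≠ ∞) (ρ : ℝ) :
    IsCompact (weakBall T k p ρ) :=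
  have := uniformConvexSpace_Lp (V := Vec k) (μ := timeMeasure T) hp1 hp
  isCompact_weakSpace_closedBall ρ

end UniformConvexity

section IntegralFunctionals

variable {E : Type*} [NormedAddCommGroup E]

lemma lowerSemicontinuous_weakSpace [NormedSpace ℝ E] {β : Type*} [LinearOrder β] {φ : E → β}
    (hconv : QuasiconvexOn ℝ Set.univ φ) (hlsc : LowerSemicontinuous φ) :
    LowerSemicontinuous fun u : WeakSpace ℝ E => φ ((toWeakSpace ℝ E).symm u) := by
  refine lowerSemicontinuous_iff_isClosed_preimage.2 fun y => ?_
  have hS : Convex ℝ (φ ⁻¹' Set.Iic y) := by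
    simpa only [Set.mem_univ, true_and, Set.preimage, Set.mem_Iic] using hconv y
  have hclosure := hS.toWeakSpace_closure ℝ
  rw [(hlsc.isClosed_preimage y).closure_eq, LinearEquiv.image_eq_preimage_symm] at hclosure
  exact closure_eq_iff_isClosed.1 hclosure.symm

variable {α : Type*} [MeasurableSpace α] {μ : Measure α} {p : ℝ≥0∞} {g : α → E → ℝ}

lemma aemeasurable_comp_of_ae_continuous (hmeas : ∀ w, AEMeasurable (fun t => g t w) μ)
    (hcont : ∀ᵐ t ∂μ, Continuous (g t)) {u : α → E} (hu : AEStronglyMeasurable u μ) :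
    AEMeasurable (fun t => g t (u t)) μ := by
  have hsimple : ∀ s : SimpleFunc α E, AEMeasurable (fun t => g t (s t)) μ := by
    intro s
    have hsum : (fun t => g t (s t))
        = fun t => ∑ w ∈ s.range, (s ⁻¹' {w}).indicator (fun t => g t w) t := by
      ext t
      rw [Finset.sum_eq_single_of_mem (s t) (s.mem_range_self t) fun w _ hw =>
        Set.indicator_of_notMem (fun ht => hw ht.symm) _]
      exact (Set.indicator_of_mem rfl _).symm
    rw [hsum]
    exact Finset.aemeasurable_fun_sum _ fun w _ => (hmeas w).indicator (s.measurableSet_fiber w)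
  refine aemeasurable_of_tendsto_metrizable_ae atTop
    (fun n => hsimple (hu.stronglyMeasurable_mk.approx n)) ?_
  filter_upwards [hcont, hu.ae_eq_mk] with t ht hut
  rw [hut]
  exact (ht.tendsto _).comp (hu.stronglyMeasurable_mk.tendsto_approx t)

lemma quasiconvexOn_lintegral_ofReal [NormedSpace ℝ E]
    (hmeas : ∀ u : Lp E p μ, AEMeasurable (fun t => g t (u t)) μ)
    (hconv : ∀ᵐ t ∂μ, ConvexOn ℝ Set.univ (g t)) :
    QuasiconvexOn ℝ Set.univ fun u : Lp E p μ => ∫⁻ t, ENNReal.ofReal (g t (u t)) ∂μ := by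
  rintro y u ⟨-, hu⟩ v ⟨-, hv⟩ a b ha hb hab
  refine ⟨Set.mem_univ _, ?_⟩
  calc ∫⁻ t, ENNReal.ofReal (g t ((a • u + b • v : Lp E p μ) t)) ∂μ
      ≤ ∫⁻ t, (ENNReal.ofReal a * ENNReal.ofReal (g t (u t))
          + ENNReal.ofReal b * ENNReal.ofReal (g t (v t))) ∂μ := by
        refine lintegral_mono_ae ?_
        filter_upwards [hconv, Lp.coeFn_add (a • u) (b • v), Lp.coeFn_smul a u, Lp.coeFn_smul b v]
          with t ht hadd hau hbv
        rw [hadd, Pi.add_apply, hau, hbv, ← ENNReal.ofReal_mul ha, ← ENNReal.ofReal_mul hb]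
        exact (ENNReal.ofReal_le_ofReal (ht.2 (Set.mem_univ _) (Set.mem_univ _) ha hb hab)).trans
          ENNReal.ofReal_add_le
    _ = ENNReal.ofReal a * ∫⁻ t, ENNReal.ofReal (g t (u t)) ∂μ
          + ENNReal.ofReal b * ∫⁻ t, ENNReal.ofReal (g t (v t)) ∂μ := by
        rw [lintegral_add_left' ((hmeas u).ennreal_ofReal.const_mul _),
          lintegral_const_mul'' _ (hmeas u).ennreal_ofReal,
          lintegral_const_mul'' _ (hmeas v).ennreal_ofReal]
    _ ≤ ENNReal.ofReal a * y + ENNReal.ofReal b * y := by gcongr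
    _ = y := by rw [← add_mul, ← ENNReal.ofReal_add ha hb, hab, ENNReal.ofReal_one, one_mul]

lemma lowerSemicontinuous_lintegral_ofReal [Fact (1 ≤ p)]
    (hmeas : ∀ u : Lp E p μ, AEMeasurable (fun t => g t (u t)) μ)
    (hlsc : ∀ᵐ t ∂μ, LowerSemicontinuous (g t)) :
    LowerSemicontinuous fun u : Lp E p μ => ∫⁻ t, ENNReal.ofReal (g t (u t)) ∂μ := by
  refine lowerSemicontinuous_iff_isClosed_preimage.2 fun y => IsSeqClosed.isClosed ?_
  intro u v hu huv
  obtain ⟨n, -, hn⟩ := (tendstoInMeasure_of_tendsto_Lp huv).exists_seq_tendsto_ae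
  calc ∫⁻ t, ENNReal.ofReal (g t (v t)) ∂μ
      ≤ ∫⁻ t, liminf (fun i => ENNReal.ofReal (g t (u (n i) t))) atTop ∂μ := by
        refine lintegral_mono_ae ?_
        filter_upwards [hn, hlsc] with t htendsto ht
        have hlsc' : LowerSemicontinuous fun w => ENNReal.ofReal (g t w) :=
          ENNReal.continuous_ofReal.comp_lowerSemicontinuous ht fun _ _ => ENNReal.ofReal_le_ofReal
        exact (hlsc'.le_liminf _).trans (liminf_le_liminf_of_le htendsto)
    _ ≤ liminf (fun i => ∫⁻ t, ENNReal.ofReal (g t (u (n i) t)) ∂μ) atTop :=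
        lintegral_liminf_le' fun i => (hmeas _).ennreal_ofReal
    _ ≤ y := liminf_le_of_frequently_le' (.of_forall fun i => hu (n i))

end IntegralFunctionals

section ExtIntegral

variable {μ : Measure ℝ} {g h c : ℝ → ℝ}

lemma extIntegral_mono_ae (hgh : ∀ᵐ t ∂μ, g t ≤ h t) : extIntegral μ g ≤ extIntegral μ h := by
  refine EReal.sub_le_sub (EReal.coe_ennreal_le_coe_ennreal_iff.2 (lintegral_mono_ae ?_))
    (EReal.coe_ennreal_le_coe_ennreal_iff.2 (lintegral_mono_ae ?_)) <;>
  filter_upwards [hgh] with t ht <;> gcongr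

lemma extIntegral_eq_integral (hg : Integrable g μ) :
    extIntegral μ g = ((∫ t, g t ∂μ : ℝ) : EReal) := by
  have hneg : ∫⁻ t, ENNReal.ofReal (-g t) ∂μ < ∞ := hg.neg.lintegral_lt_top
  rw [integral_eq_lintegral_pos_part_sub_lintegral_neg_part hg, EReal.coe_sub,
    EReal.coe_ennreal_toReal hg.lintegral_lt_top.ne, EReal.coe_ennreal_toReal hneg.ne, extIntegral]

lemma extIntegral_eq_lintegral_sub_integral (hg : AEMeasurable g μ) (hc : Integrable c μ)
    (hgc : ∀ᵐ t ∂μ, -c t ≤ g t) : extIntegral μ g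
      = ((∫⁻ t, ENNReal.ofReal (g t + c t) ∂μ : ℝ≥0∞) : EReal) - ((∫ t, c t ∂μ : ℝ) : EReal) := by
  have hneg : ∫⁻ t, ENNReal.ofReal (-g t) ∂μ ≠ ∞ := by
    refine ne_top_of_le_ne_top hc.lintegral_lt_top.ne (lintegral_mono_ae ?_)
    filter_upwards [hgc] with t ht
    exact ENNReal.ofReal_le_ofReal (neg_le.1 ht)
  have hnonneg : 0 ≤ᵐ[μ] fun t => g t + c t := hgc.mono fun t ht => by simpa using by linarith
  by_cases htop : ∫⁻ t, ENNReal.ofReal (g t + c t) ∂μ = ∞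
  · have hpos : ∫⁻ t, ENNReal.ofReal (g t) ∂μ = ∞ := by
      by_contra hpos
      refine (ENNReal.add_lt_top.2 ⟨lt_top_iff_ne_top.2 hpos, hc.lintegral_lt_top⟩).ne
        (top_le_iff.1 ?_)
      rw [← htop, ← lintegral_add_left' hg.ennreal_ofReal]
      exact lintegral_mono fun t => ENNReal.ofReal_add_le
    rw [extIntegral, htop, hpos, EReal.coe_ennreal_top, EReal.top_sub_coe,
      ← EReal.coe_ennreal_toReal hneg, EReal.top_sub_coe]
  · have hint : Integrable (fun t => g t + c t) μ :=
      (lintegral_ofReal_ne_top_iff_integrable (hg.add hc.aemeasurable).aestronglyMeasurable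
        hnonneg).1 htop
    have hgint : Integrable g μ := (hint.sub hc).congr (.of_forall fun t => by simp)
    rw [extIntegral_eq_integral hgint, ← ofReal_integral_eq_lintegral_ofReal hint hnonneg,
      EReal.coe_ennreal_ofReal, max_eq_left (integral_nonneg_of_ae hnonneg),
      integral_add hgint hc, ← EReal.coe_sub, add_sub_cancel_right]

end ExtIntegral

section RunningCost

variable {k : ℕ} {T : ℝ} {p : ℝ≥0∞} {f : ℝ → Vec k → ℝ}

lemma RunningCost.exists_extIntegral_eq_coe (hf : RunningCost T p f) :
    ∃ (u : Control T k p) (κ : ℝ), extIntegral (timeMeasure T) (fun t => f t (u t)) = κ := by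
  obtain ⟨w, c, hc, -, hfc⟩ := hf.finite
  let u : Control T k p := (memLp_const w).toLp
  have hmeas := aemeasurable_comp_of_ae_continuous hf.measurable hf.continuous
    (Lp.aestronglyMeasurable u)
  refine ⟨u, _, extIntegral_eq_integral (hc.mono' hmeas.aestronglyMeasurable ?_)⟩
  filter_upwards [hfc, (memLp_const (p := p) (μ := timeMeasure T) w).coeFn_toLp] with t ht hut
  rwa [hut]

variable [Fact (1 ≤ p)]

theorem RunningCost.lowerSemicontinuous_extIntegral (hf : RunningCost T p f) :
    LowerSemicontinuous fun u : WeakSpace ℝ (Control T k p) =>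
      extIntegral (timeMeasure T) fun t => f t ((toWeakSpace ℝ (Control T k p)).symm u t) := by
  obtain ⟨c, C, hc, -, hC, hfc⟩ := hf.growth
  have hmeas : ∀ u : Control T k p, AEMeasurable (fun t => f t (u t)) (timeMeasure T) := fun u =>
    aemeasurable_comp_of_ae_continuous hf.measurable hf.continuous (Lp.aestronglyMeasurable u)
  have hmeas' : ∀ u : Control T k p, AEMeasurable (fun t => f t (u t) + c t) (timeMeasure T) :=
    fun u => (hmeas u).add hc.aemeasurable
  have heq : ∀ u : Control T k p, extIntegral (timeMeasure T) (fun t => f t (u t))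
      = ((∫⁻ t, ENNReal.ofReal (f t (u t) + c t) ∂timeMeasure T : ℝ≥0∞) : EReal)
        + ((-∫ t, c t ∂timeMeasure T : ℝ) : EReal) := fun u => by
    rw [EReal.coe_neg, ← sub_eq_add_neg]
    refine extIntegral_eq_lintegral_sub_integral (hmeas u) hc (hfc.mono fun t ht => ?_)
    have : 0 ≤ C * ‖u t‖ ^ p.toReal := by positivity
    linarith [ht (u t)]
  let φ : Control T k p → ℝ≥0∞ := fun u =>
    ∫⁻ t, ENNReal.ofReal (f t (u t) + c t) ∂timeMeasure T
  have hconv : QuasiconvexOn ℝ Set.univ φ := quasiconvexOn_lintegral_ofReal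
    (g := fun t w => f t w + c t) hmeas' (hf.convex.mono fun t ht => ht.add_const (c t))
  have hlsc : LowerSemicontinuous φ := lowerSemicontinuous_lintegral_ofReal
    (g := fun t w => f t w + c t) hmeas'
    (hf.continuous.mono fun t ht => (ht.add continuous_const).lowerSemicontinuous)
  simp_rw [heq]
  exact (continuous_coe_ennreal_ereal.comp_lowerSemicontinuous (lowerSemicontinuous_weakSpace
    hconv hlsc) fun _ _ => EReal.coe_ennreal_le_coe_ennreal_iff.2).add' lowerSemicontinuous_const
    fun _ => EReal.continuousAt_add (.inr (EReal.coe_ne_bot _)) (.inr (EReal.coe_ne_top _))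

theorem RunningCost.exists_mul_norm_rpow_sub_le_extIntegral (hf : RunningCost T p f)
    (hp : p ≠ ∞) : ∃ C κ : ℝ, 0 < C ∧ ∀ u : Control T k p,
      ((C * ‖u‖ ^ p.toReal - κ : ℝ) : EReal)
        ≤ extIntegral (timeMeasure T) fun t => f t (u t) := by
  have hp0 : p ≠ 0 := (one_pos.trans_le (Fact.out : 1 ≤ p)).ne'
  obtain ⟨c, C, hc, -, hC, hfc⟩ := hf.growth
  refine ⟨C, ∫ t, c t ∂timeMeasure T, hC, fun u => ?_⟩
  have hu : Integrable (fun t => C * ‖u t‖ ^ p.toReal) (timeMeasure T) :=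
    ((Lp.memLp u).integrable_norm_rpow hp0 hp).const_mul C
  rw [norm_rpow_eq_integral hp, ← integral_const_mul, ← integral_sub hu hc]
  exact (extIntegral_eq_integral (hu.sub hc)).symm.trans_le
    (extIntegral_mono_ae (hfc.mono fun t ht => ht (u t)))

lemma RunningCost.extIntegral_ne_bot (hf : RunningCost T p f) (hp : p ≠ ∞) (u : Control T k p) :
    extIntegral (timeMeasure T) (fun t => f t (u t)) ≠ ⊥ := by
  obtain ⟨C, κ, -, hle⟩ := hf.exists_mul_norm_rpow_sub_le_extIntegral hp
  exact ne_bot_of_le_ne_bot (EReal.coe_ne_bot _) (hle u)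

end RunningCost

section GammaConvergence

lemma exists_pos_add_coe_lt {b c : EReal} (hbc : b < c) :
    ∃ ε : ℝ, 0 < ε ∧ b + (ε : EReal) < c := by
  obtain ⟨r, hbr, hrc⟩ := EReal.lt_iff_exists_real_btwn.1 hbc
  obtain ⟨s, hrs, hsc⟩ := EReal.lt_iff_exists_real_btwn.1 hrc
  refine ⟨s - r, sub_pos.2 (EReal.coe_lt_coe_iff.1 hrs), ?_⟩
  calc b + ((s - r : ℝ) : EReal) ≤ r + ((s - r : ℝ) : EReal) := by gcongr
    _ = s := by rw [← EReal.coe_add, add_sub_cancel]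
    _ < c := hsc

variable {ι X : Type*} {l : Filter ι} {G : ι → X → EReal} {G' : X → EReal}

/-- Uniform convergence of extended real functionals along a filter, measured by additive real
errors; in particular the functionals eventually take infinite values at the same points. -/
def TendstoUniformlyAdd (G : ι → X → EReal) (G' : X → EReal) (l : Filter ι) : Prop :=
  ∀ ε : ℝ, 0 < ε → ∀ᶠ i in l, ∀ x, G i x ≤ G' x + (ε : EReal) ∧ G' x ≤ G i x + (ε : EReal)

namespace TendstoUniformlyAdd

lemma tendsto (h : TendstoUniformlyAdd G G' l) (x : X) :
    Tendsto (fun i => G i x) l (𝓝 (G' x)) := by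
  refine tendsto_order.2 ⟨fun c hc => ?_, fun c hc => ?_⟩ <;>
    obtain ⟨ε, hε, hlt⟩ := exists_pos_add_coe_lt hc <;> filter_upwards [h ε hε] with i hi
  · exact lt_of_add_lt_add_right (hlt.trans_le (hi x).2)
  · exact (hi x).1.trans_lt hlt

lemma iInf (h : TendstoUniformlyAdd G G' l) :
    TendstoUniformlyAdd (fun i (_ : Unit) => ⨅ x, G i x) (fun _ => ⨅ x, G' x) l := by
  have hiInf : ∀ {g g' : X → EReal} {ε : ℝ}, (∀ x, g x ≤ g' x + (ε : EReal)) →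
      ⨅ x, g x ≤ (⨅ x, g' x) + (ε : EReal) := fun {g g' ε} hg =>
    (EReal.sub_le_iff_le_add (.inl (EReal.coe_ne_bot _)) (.inl (EReal.coe_ne_top _))).1
      (le_iInf fun x => EReal.sub_le_of_le_add ((iInf_le g x).trans (hg x)))
  exact fun ε hε => (h ε hε).mono fun i hi _ =>
    ⟨hiInf fun x => (hi x).1, hiInf fun x => (hi x).2⟩

lemma tendsto_iInf (h : TendstoUniformlyAdd G G' l) :
    Tendsto (fun i => ⨅ x, G i x) l (𝓝 (⨅ x, G' x)) :=
  h.iInf.tendsto ()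

variable [TopologicalSpace X]

lemma le_liminf (h : TendstoUniformlyAdd G G' l) {u : ι → X} {v : X}
    (hG' : LowerSemicontinuousAt G' v) (hu : Tendsto u l (𝓝 v)) :
    G' v ≤ liminf (fun i => G i (u i)) l := by
  refine le_of_forall_lt_imp_le_of_dense fun c hc => le_liminf_of_le (by isBoundedDefault) ?_
  obtain ⟨ε, hε, hlt⟩ := exists_pos_add_coe_lt hc
  filter_upwards [h ε hε, hu.eventually (hG' _ hlt)] with i hi hui
  exact (lt_of_add_lt_add_right (hui.trans_le (hi (u i)).2)).le

theorem gammaConverges {G : ℕ → X → EReal} (h : TendstoUniformlyAdd G G' atTop)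
    (hG' : LowerSemicontinuous G') : GammaConverges G G' where
  liminf_le _ v hu := h.le_liminf (hG' v) hu
  limsup_le v := ⟨fun _ => v, tendsto_const_nhds, (h.tendsto v).limsup_eq.le⟩

theorem isMinimizer_of_mapClusterPt (h : TendstoUniformlyAdd G G' l) {u : ι → X} {v : X}
    (hG' : LowerSemicontinuousAt G' v) (hu : ∀ i, IsMinimizer (G i) (u i))
    (hv : MapClusterPt v l u) : IsMinimizer G' v := by
  intro w
  by_contra! hwv
  obtain ⟨ε, hε, hlt⟩ := exists_pos_add_coe_lt hwv
  obtain ⟨i, hlt', hi⟩ := ((hv.frequently (hG' _ hlt)).and_eventually (h _ (half_pos hε))).exists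
  refine hlt'.not_ge ?_
  calc G' (u i) ≤ G i (u i) + ((ε / 2 : ℝ) : EReal) := (hi _).2
    _ ≤ G i w + ((ε / 2 : ℝ) : EReal) := by gcongr; exact hu i w
    _ ≤ G' w + ((ε / 2 : ℝ) : EReal) + ((ε / 2 : ℝ) : EReal) := by gcongr; exact (hi w).1
    _ = G' w + (ε : EReal) := by rw [add_assoc, ← EReal.coe_add, add_halves]

end TendstoUniformlyAdd

end GammaConvergence

section Minimax

variable {d k l : ℕ} {T : ℝ} {p : ℝ≥0∞} {Θ S S' : Set (Vec l)}
  {F₀ : Vec d → Vec l → Vec d} {F : Vec d → Vec l → Fin k → Vec d}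
  {x₀ : Vec l → Vec d} {a : Vec d → Vec l → ℝ} {f : ℝ → Vec k → ℝ}

lemma minimaxCost_le_minimaxCost_add {u : Control T k p} {ε : ℝ}
    (h : ∀ θ ∈ S, ∃ θ' ∈ S',
      endpointCost T F₀ F x₀ a θ u ≤ endpointCost T F₀ F x₀ a θ' u + ε) :
    minimaxCost T F₀ F x₀ a f S u ≤ minimaxCost T F₀ F x₀ a f S' u + (ε : EReal) := by
  rw [minimaxCost, minimaxCost, add_right_comm]
  gcongr
  refine iSup₂_le fun θ hθ => ?_
  obtain ⟨θ', hθ', hle⟩ := h θ hθ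
  calc (endpointCost T F₀ F x₀ a θ u : EReal) ≤ (endpointCost T F₀ F x₀ a θ' u + ε : ℝ) :=
        EReal.coe_le_coe_iff.2 hle
    _ ≤ _ := by rw [EReal.coe_add]; gcongr; exact le_iSup₂_of_le θ' hθ' le_rfl

variable [Fact (1 ≤ p)]

lemma minimaxCost_ne_bot (hf : RunningCost T p f) (hp : p ≠ ∞) (hS : S.Nonempty)
    (u : Control T k p) : minimaxCost T F₀ F x₀ a f S u ≠ ⊥ := by
  obtain ⟨θ, hθ⟩ := hS
  exact EReal.add_ne_bot_iff.2 ⟨ne_bot_of_le_ne_bot (EReal.coe_ne_bot _)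
    (le_iSup₂_of_le θ hθ le_rfl), hf.extIntegral_ne_bot hp u⟩

theorem lowerSemicontinuous_restrictBall_minimaxCost (hF : LipschitzFields Θ F₀ F) (hT : 0 ≤ T)
    (hx₀ : ContinuousOn x₀ Θ) (ha : TerminalCost Θ a) (hf : RunningCost T p f) (hp1 : 1 < p)
    (hp : p ≠ ∞) (hSΘ : S ⊆ Θ) (hS : S.Nonempty) (ρ : ℝ) :
    LowerSemicontinuous (restrictBall (p := p) ρ (minimaxCost T F₀ F x₀ a f S)) := by
  have hcont := hF.continuous_endpointCost (k := k) hT hx₀ ha hp1 ρ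
  refine LowerSemicontinuous.add' (lowerSemicontinuous_biSup fun θ hθ => ?_)
    (hf.lowerSemicontinuous_extIntegral.comp continuous_subtype_val) fun u => ?_
  · exact (continuous_coe_real_ereal.comp
      (hcont.comp (Continuous.prodMk_right ⟨θ, hSΘ hθ⟩))).lowerSemicontinuous
  · obtain ⟨θ, hθ⟩ := hS
    exact EReal.continuousAt_add (.inr (hf.extIntegral_ne_bot hp _))
      (.inl (ne_bot_of_le_ne_bot (EReal.coe_ne_bot _) (le_iSup₂_of_le θ hθ le_rfl)))

theorem tendstoUniformlyAdd_restrictBall_minimaxCost (hF : LipschitzFields Θ F₀ F) (hT : 0 ≤ T)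
    (hΘ : IsCompact Θ) (hx₀ : ContinuousOn x₀ Θ) (ha : TerminalCost Θ a) (hp1 : 1 < p)
    (hp : p ≠ ∞) {ι : Type*} {𝓕 : Filter ι} {Sι : ι → Set (Vec l)}
    (hSι : ∀ i, Sι i ⊆ Θ ∧ (Sι i).Nonempty) (hSΘ : S ⊆ Θ) (hS : S.Nonempty)
    (hlim : Tendsto (fun i => Metric.hausdorffDist (Sι i) S) 𝓕 (𝓝 0)) (ρ : ℝ) :
    TendstoUniformlyAdd (fun i => restrictBall (p := p) ρ (minimaxCost T F₀ F x₀ a f (Sι i)))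
      (restrictBall ρ (minimaxCost T F₀ F x₀ a f S)) 𝓕 := by
  intro ε hε
  have := isCompact_iff_compactSpace.1 hΘ
  have := isCompact_iff_compactSpace.1 (isCompact_weakBall (T := T) (k := k) hp1 hp ρ)
  obtain ⟨δ, hδ, hmod⟩ := exists_dist_lt_of_continuous
    (hF.continuous_endpointCost (k := k) hT hx₀ ha hp1 ρ) hε
  filter_upwards [hlim.eventually (gt_mem_nhds hδ)] with i hi u
  have hfin : Metric.hausdorffEDist (Sι i) S ≠ ⊤ :=
    Metric.hausdorffEDist_ne_top_of_nonempty_of_bounded (hSι i).2 hS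
      (hΘ.isBounded.subset (hSι i).1) (hΘ.isBounded.subset hSΘ)
  constructor <;> refine minimaxCost_le_minimaxCost_add fun θ hθ => ?_
  · obtain ⟨θ', hθ', hdist⟩ := Metric.exists_dist_lt_of_hausdorffDist_lt hθ hi hfin
    have hlt := hmod ⟨θ, (hSι i).1 hθ⟩ ⟨θ', hSΘ hθ'⟩ hdist u
    exact ⟨θ', hθ', by linarith [(abs_lt.1 hlt).2]⟩
  · obtain ⟨θ', hθ', hdist⟩ := Metric.exists_dist_lt_of_hausdorffDist_lt' hθ hi hfin
    have hlt := hmod ⟨θ', (hSι i).1 hθ'⟩ ⟨θ, hSΘ hθ⟩ hdist u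
    exact ⟨θ', hθ', by linarith [(abs_lt.1 hlt).1]⟩

theorem exists_norm_le_of_isMinimizer_minimaxCost (hF : LipschitzFields Θ F₀ F) (hT : 0 ≤ T)
    (hΘ : IsCompact Θ) (hx₀ : ContinuousOn x₀ Θ) (ha : TerminalCost Θ a)
    (hf : RunningCost T p f) (hp1 : 1 < p) (hp : p ≠ ∞) :
    ∃ ρ : ℝ, 0 < ρ ∧ ∀ S ⊆ Θ, S.Nonempty → ∀ u : Control T k p,
      IsMinimizer (minimaxCost T F₀ F x₀ a f S) u → ‖u‖ ≤ ρ := by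
  obtain ⟨C, κ, hC, hcoercive⟩ := hf.exists_mul_norm_rpow_sub_le_extIntegral hp
  obtain ⟨u₀, κ₀, hu₀⟩ := hf.exists_extIntegral_eq_coe
  obtain ⟨A, hA⟩ := hΘ.exists_bound_of_continuousOn
    (hF.continuousOn_endpointCost hT hx₀ ha hp1 u₀)
  refine ⟨max 1 ((A + κ₀ + κ) / C), by positivity, fun S hSΘ ⟨θ, hθ⟩ u hu => ?_⟩
  have hupper : minimaxCost T F₀ F x₀ a f S u₀ ≤ (A : EReal) + (κ₀ : EReal) := by
    refine add_le_add (iSup₂_le fun θ hθ => EReal.coe_le_coe_iff.2 ?_) hu₀.le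
    exact (le_abs_self _).trans (hA θ (hSΘ hθ))
  have hlower : (0 : EReal) + ((C * ‖u‖ ^ p.toReal - κ : ℝ) : EReal)
      ≤ minimaxCost T F₀ F x₀ a f S u :=
    add_le_add (le_iSup₂_of_le θ hθ (EReal.coe_nonneg.2 (ha.nonneg _ θ (hSΘ hθ)))) (hcoercive u)
  have hle := hlower.trans ((hu u₀).trans hupper)
  rw [zero_add, ← EReal.coe_add, EReal.coe_le_coe_iff] at hle
  rcases le_total ‖u‖ 1 with hu1 | hu1
  · exact hu1.trans (le_max_left _ _)
  have hp1' : 1 ≤ p.toReal := (ENNReal.dichotomy p).resolve_left hp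
  have hnorm := mul_le_mul_of_nonneg_left (Real.self_le_rpow_of_one_le hu1 hp1') hC.le
  exact ((le_div_iff₀ hC).2 (by linarith)).trans (le_max_right _ _)

end Minimax

end MinimaxEnsemble

open MinimaxEnsemble in
theorem mainTheorem2_general {d k l : ℕ} {T : ℝ} (hT : 0 ≤ T)
    {p : ℝ≥0∞} [Fact (1 ≤ p)] (hp1 : 1 < p) (hp : p ≠ ∞)
    {Θ : Set (Vec l)} (hΘ : IsCompact Θ)
    {F₀ : Vec d → Vec l → Vec d} {F : Vec d → Vec l → Fin k → Vec d} (hF : LipschitzFields Θ F₀ F)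
    {x₀ : Vec l → Vec d} (hx₀ : ContinuousOn x₀ Θ)
    {a : Vec d → Vec l → ℝ} (ha : TerminalCost Θ a)
    {f : ℝ → Vec k → ℝ} (hf : RunningCost T p f)
    {ΘN : ℕ → Set (Vec l)} (hΘN : ∀ N, ΘN N ⊆ Θ ∧ (ΘN N).Nonempty)
    {Θinf : Set (Vec l)} (hΘinf : Θinf ⊆ Θ ∧ Θinf.Nonempty)
    (hlim : Tendsto (fun N => Metric.hausdorffDist (ΘN N) Θinf) atTop (𝓝 0)) :
    (∀ u : Control T k p, ∀ θ ∈ Θ,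
      IsTrajectory T F₀ F x₀ u θ (trajectory T F₀ F x₀ u θ) ∧
      ∀ x, IsTrajectory T F₀ F x₀ u θ x →
        Set.EqOn x (trajectory T F₀ F x₀ u θ) (Set.Icc 0 T)) ∧
    (∀ u : Control T k p, ∀ S ⊆ Θ, S.Nonempty →
      (IsCompact S → ∃ θ ∈ S, IsMaxOn (fun θ => a (trajectory T F₀ F x₀ u θ T) θ) S θ) ∧
      minimaxCost T F₀ F x₀ a f S u ≠ ⊥) ∧
    (∃ ρ : ℝ, 0 < ρ ∧ ∀ S ⊆ Θ, S.Nonempty → ∀ u : Control T k p,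
      IsMinimizer (minimaxCost T F₀ F x₀ a f S) u → ‖u‖ ≤ ρ) ∧
    ∀ ρ : ℝ,
      let JN (N : ℕ) := restrictBall (p := p) ρ (minimaxCost T F₀ F x₀ a f (ΘN N))
      let Jinf := restrictBall (p := p) ρ (minimaxCost T F₀ F x₀ a f Θinf)
      GammaConverges JN Jinf ∧
      Tendsto (fun N => ⨅ u, JN N u) atTop (𝓝 (⨅ u, Jinf u)) ∧
      ∀ u : ℕ → weakBall T k p ρ, (∀ N, IsMinimizer (JN N) (u N)) →
        IsCompact (closure (Set.range u)) ∧
        ∀ v : weakBall T k p ρ, MapClusterPt v atTop u → IsMinimizer Jinf v := by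
  refine ⟨fun u θ hθ => ?_, fun u S hSΘ hS => ⟨fun hSc => ?_, minimaxCost_ne_bot hf hp hS u⟩,
    exists_norm_le_of_isMinimizer_minimaxCost hF hT hΘ hx₀ ha hf hp1 hp, fun ρ => ?_⟩
  · have hu := intervalIntegrable_Lp hT u
    have htraj := hF.isTrajectory_trajectory hT hθ hu x₀
    exact ⟨htraj, fun x hx => hF.eqOn_of_isTrajectory hθ hu hx htraj⟩
  · exact hSc.exists_isMaxOn hS ((hF.continuousOn_endpointCost hT hx₀ ha hp1 u).mono hSΘ)
  · have hunif := tendstoUniformlyAdd_restrictBall_minimaxCost (f := f) hF hT hΘ hx₀ ha hp1 hp hΘN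
      hΘinf.1 hΘinf.2 hlim ρ
    have hlsc := lowerSemicontinuous_restrictBall_minimaxCost hF hT hx₀ ha hf hp1 hp hΘinf.1
      hΘinf.2 ρ
    have := isCompact_iff_compactSpace.1 (isCompact_weakBall (T := T) (k := k) hp1 hp ρ)
    exact ⟨hunif.gammaConverges hlsc, hunif.tendsto_iInf, fun u hu =>
      ⟨isClosed_closure.isCompact, fun v hv => hunif.isMinimizer_of_mapClusterPt (hlsc v) hu hv⟩⟩

open MinimaxEnsemble in
theorem mainTheorem2 {d k l : ℕ} (T : ℝ) (hT : 0 < T)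
    (p : ℝ≥0∞) [Fact (1 ≤ p)] (hp1 : 1 < p) (hp : p ≠ ∞)
    (Θ : Set (Vec l)) (hΘ : IsCompact Θ)
    (F₀ : Vec d → Vec l → Vec d) (F : Vec d → Vec l → Fin k → Vec d) (hF : LipschitzFields Θ F₀ F)
    (x₀ : Vec l → Vec d) (hx₀ : ContinuousOn x₀ Θ)
    (a : Vec d → Vec l → ℝ) (ha : TerminalCost Θ a)
    (f : ℝ → Vec k → ℝ) (hf : RunningCost T p f)
    (ΘN : ℕ → Set (Vec l)) (hΘN : ∀ N, ΘN N ⊆ Θ ∧ IsCompact (ΘN N) ∧ (ΘN N).Nonempty)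
    (Θinf : Set (Vec l)) (hΘinf : Θinf ⊆ Θ ∧ IsCompact Θinf ∧ Θinf.Nonempty)
    (hlim : Tendsto (fun N => Metric.hausdorffDist (ΘN N) Θinf) atTop (𝓝 0))
    (JN : ℕ → Control T k p → EReal) (hJN : ∀ N, JN N = minimaxCost T F₀ F x₀ a f (ΘN N))
    (Jinf : Control T k p → EReal) (hJinf : Jinf = minimaxCost T F₀ F x₀ a f Θinf) :
    -- The functionals are well defined: the trajectories exist and are unique,
    -- the maxima are attained, and the value is never `-∞`.
    (∀ u : Control T k p, ∀ θ ∈ Θ,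
      IsTrajectory T F₀ F x₀ u θ (trajectory T F₀ F x₀ u θ) ∧
      ∀ x, IsTrajectory T F₀ F x₀ u θ x →
        Set.EqOn x (trajectory T F₀ F x₀ u θ) (Set.Icc 0 T)) ∧
    (∀ u : Control T k p, ∀ S : Set (Vec l), S ⊆ Θ → IsCompact S → S.Nonempty →
      (∃ θ ∈ S, IsMaxOn (fun θ => a (trajectory T F₀ F x₀ u θ T) θ) S θ) ∧
      minimaxCost T F₀ F x₀ a f S u ≠ ⊥) ∧
    -- Some ball contains all the minimizers.
    (∃ ρ : ℝ, 0 < ρ ∧ (∀ N u, IsMinimizer (JN N) u → ‖u‖ ≤ ρ) ∧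
      ∀ u, IsMinimizer Jinf u → ‖u‖ ≤ ρ) ∧
    -- On every such ball, with the weak topology:
    ∀ ρ : ℝ, 0 < ρ → (∀ N u, IsMinimizer (JN N) u → ‖u‖ ≤ ρ) →
      (∀ u, IsMinimizer Jinf u → ‖u‖ ≤ ρ) →
      GammaConverges (fun N => restrictBall ρ (JN N)) (restrictBall ρ Jinf) ∧
      Tendsto (fun N => ⨅ u, restrictBall ρ (JN N) u) atTop (𝓝 (⨅ u, restrictBall ρ Jinf u)) ∧
      ∀ u : ℕ → weakBall T k p ρ, (∀ N, IsMinimizer (restrictBall ρ (JN N)) (u N)) →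
        IsCompact (closure (Set.range u)) ∧
        ∀ v : weakBall T k p ρ, MapClusterPt v atTop u → IsMinimizer (restrictBall ρ Jinf) v := by
  subst hJinf
  obtain rfl : JN = fun N => minimaxCost T F₀ F x₀ a f (ΘN N) := funext hJN
  obtain ⟨htraj, hmax, ⟨ρ₀, hρ₀, hmin⟩, hball⟩ := mainTheorem2_general hT.le hp1 hp hΘ hF hx₀ ha hf
    (fun N => ⟨(hΘN N).1, (hΘN N).2.2⟩) ⟨hΘinf.1, hΘinf.2.2⟩ hlim
  exact ⟨htraj, fun u S hSΘ hSc hS => ⟨(hmax u S hSΘ hS).1 hSc, (hmax u S hSΘ hS).2⟩,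
    ⟨ρ₀, hρ₀, fun N => hmin _ (hΘN N).1 (hΘN N).2.2, hmin _ hΘinf.1 hΘinf.2.2⟩,
    fun ρ _ _ _ => hball ρ⟩
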